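/- **Setting.** Time is discrete. Three blockchains $\Pi_0,\Pi_1,\Pi_2$ run in a partially synchronous network: there is an unknown global stabilization time $\mathrm{GST}$, and after it messages of honest parties are delivered within a known $\Delta$. Their clients confirm ledgers (lists of blocks, each with an epoch number) from sets of broadcast consensus messages, with a confirmation rule $C_k$. Everything on a ledger from its first invalid block on (a block with an incorrect certificate or an early timer) is discarded. A protocol * is *safe* if the ledgers of any two clients at any two times are consistent (one is a prefix of the other) and the ledger of a client is only ever extended; * is *live after GST with latency $\ell$* if every valid transaction input to all honest validators at time $t$ is, from time $\max(\mathrm{GST},t)+\ell$ on, in the ledger of every online client, in a block dated at most $\max(\mathrm{GST},t)+\ell$ (a block of epoch $e$ is dated $eT$; for safe chains that proceed in epochs this clause about dates is automatic); * *proceeds in epochs of fixed duration $T$* if along every finalized chain the epoch numbers increase strictly and a block of epoch $e$ is finalized at time $eT$ or later (so a chain finalized at time $t$ has at most $t/T+1$ blocks); * *generates certificates*, when run with security parameter $\varepsilon$, if, under the conditions for its safety, the probability that there are a time $t$ and sets $M_1,M_2$ of consensus messages broadcast by time $t$ such that $C(M_1)$, $C(M_2)$ have conflicting prefixes is less than $\varepsilon$.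 **The triangular composition** $\Pi_t$. On each $\Pi_k$ a smart contract emulates one validator of the following leader-based, omission-fault-tolerant protocol. Overlay epochs $v\ge 1$ have three phases of length $T_c$ each and the leader $v \bmod 3$; the contract reads the time off the epoch numbers of the blocks of $\Pi_k$ and acts at the first block in a new phase. (Phase 0) The leader proposes a block with all outstanding transactions. It extends a block for which it has observed a certificate of epoch $v-1$, i.e. acknowledgements for epoch $v-1$ from two validators (the genesis block counts as certified at epoch $0$). Without such a certificate, but with leader-down messages for epoch $v-1$ from two validators, it extends the block with the highest epoch in these messages. Otherwise it proposes nothing. (Phase 1) Validators acknowledge the proposals of the leader for epoch $v$ that they have observed. (Phase 2) A validator that has observed no certificate for epoch $v$ sends a leader-down message with the block of highest epoch that it has acknowledged. A validator commits a block, with its prefix chain, once it has observed the proposal of the correct leader and a certificate for it. The contracts exchange messages, accompanied by certificates of finality, by cross-chain communication: what is read on a chain is part of the ledger finalized by some client of the source chain, and honest validators write every overlay message that they observe on some ledger (sent by the contract or recorded there) to all three chains, with at most the network delay. They also submit a timer transaction to their chain at the start of each of its epochs. A client of $\Pi_t$ reads the three ledgers (all that it has observed so far), accepts a block and its prefix chain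 when the validators emulated on two chains have committed it, and appends what it accepts to its ledger, keeping only first occurrences of blocks and transactions. The input of $\Pi_t$ is what is input to all honest validators of all three chains. **Theorem.** Let $\Pi_0,\Pi_1,\Pi_2$ proceed in epochs of fixed durations $T_0,T_1,T_2$. There is a universal constant $c$ such that, under partial synchrony and for every adversary: 1. In every execution in which $\Pi_0,\Pi_1,\Pi_2$ are all safe, $\Pi_t$ is safe. 2. If $T_c$ bounds the cross-chain latency, in the sense that $T_k+2T_{\mathrm{conf}}+\Delta\le T_c$ for all $k$, then in every execution in which at least two of the three chains are live after GST with latency $T_{\mathrm{conf}}$, safe or not, $\Pi_t$ is live after GST with the constant latency $c\,T_c$. 3. If $\Pi_k$, run with security parameter $\varepsilon_k$, generates certificates for $k=0,1,2$, then $\Pi_t$ generates certificates with security parameter $\varepsilon_0+\varepsilon_1+\varepsilon_2$, under the conjunction of the conditions for the safety of the three chains. 4. $\Pi_t$ proceeds in epochs of fixed duration $3T_c$: this holds for all overlay chains accepted by clients, in every execution, and for the ledger of $\Pi_t$ if all three chains are safe. -/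

import Mathlib

/-! ### Blocks and ledgers

Time is discrete (`ℕ`).  A ledger is the list of its blocks, oldest first and without the
genesis block; a block carries the number of the epoch in which it was proposed. -/

/-- A block: the number of its epoch and its transactions. -/
structure Block (X : Type) where
  epoch : ℕ
  txs : List X
  deriving DecidableEq

/-- The transactions of a ledger, in order. -/
def txsOf {X : Type} (L : List (Block X)) : List X := L.flatMap Block.txs

/-- Two ledgers are consistent if one of them is a prefix of the other. -/
def Consistent {A : Type} (L L' : List A) : Prop := L <+: L' ∨ L' <+: L

/-! ### Security notions

They are stated for an arbitrary protocol, given by the ledger `V z t` that client `z` outputs at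
time `t` when it is online (`online z t`). -/

/-- Safety: the ledgers of any two clients at any two times are consistent, and the ledger of a
client never shrinks or changes. -/
def Safe {Client X : Type} (online : Client → ℕ → Prop) (V : Client → ℕ → List (Block X)) :
    Prop :=
  (∀ z z' t t', online z t → online z' t' → Consistent (V z t) (V z' t')) ∧
  (∀ z t t', online z t → online z t' → t ≤ t' → V z t <+: V z t')

/-- Liveness with latency `ℓ` after `GST`, for a protocol with epochs of duration `T`: a
transaction that is input to all honest validators at time `t` is, from time `max GST t + ℓ` on,
in the ledger of every client, in a block that the ledger itself dates (block of epoch `e`: time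
`e * T`) no later than `max GST t + ℓ`. -/
def LiveAfter {Client X : Type} (online : Client → ℕ → Prop) (GST ℓ T : ℕ)
    (input : X → ℕ → Prop) (V : Client → ℕ → List (Block X)) : Prop :=
  ∀ x t, input x t → ∀ z t', online z t' → max GST t + ℓ ≤ t' →
    ∃ b ∈ V z t', x ∈ b.txs ∧ b.epoch * T ≤ max GST t + ℓ

/-- A protocol proceeds in epochs of fixed duration `T`: a chain has at most one block for each
epoch, in the order of the epochs, and no client finalizes a block of epoch `e` before time
`e * T`.  Here `chains z t` are the chains finalized by client `z` at time `t`. -/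
def ProceedsInEpochs {Client X : Type} (online : Client → ℕ → Prop) (T : ℕ)
    (chains : Client → ℕ → Set (List (Block X))) : Prop :=
  0 < T ∧ ∀ z t, online z t → ∀ L ∈ chains z t,
    L.Pairwise (fun b b' => b.epoch < b'.epoch) ∧ ∀ b ∈ L, b.epoch * T ≤ t

/-- The chain growth rate is then at most one block every `T` time steps. -/
theorem ProceedsInEpochs.length_le {Client X : Type} {online : Client → ℕ → Prop} {T : ℕ}
    {chains : Client → ℕ → Set (List (Block X))} (h : ProceedsInEpochs online T chains)
    {z : Client} {t : ℕ} (hz : online z t) {L : List (Block X)} (hL : L ∈ chains z t) :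
    L.length ≤ t / T + 1 := by
  obtain ⟨hT, h⟩ := h
  obtain ⟨h1, h2⟩ := h z t hz L hL
  have hnd : (L.map Block.epoch).Nodup := by
    rw [List.Nodup, List.pairwise_map]
    exact h1.imp (fun hlt => Nat.ne_of_lt hlt)
  have hsub : (L.map Block.epoch) ⊆ List.range (t / T + 1) := by
    intro e he
    obtain ⟨b, hb, rfl⟩ := List.mem_map.1 he
    exact List.mem_range.2 (Nat.lt_succ_of_le ((Nat.le_div_iff_mul_le hT).2 (h2 b hb)))
  simpa using (hnd.subperm hsub).length_le

/-- For a safe protocol that proceeds in epochs, with some client online at every time, the dates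
in `LiveAfter` come for free: it suffices that transactions are included in time. -/
theorem LiveAfter.of_safe {Client X : Type} {online : Client → ℕ → Prop} {GST ℓ T : ℕ}
    {input : X → ℕ → Prop} {V : Client → ℕ → List (Block X)} (hsafe : Safe online V)
    (hepoch : ProceedsInEpochs online T fun z t => {V z t}) (hon : ∀ t, ∃ z, online z t)
    (hlive : ∀ x t, input x t → ∀ z t', online z t' → max GST t + ℓ ≤ t' →
      ∃ b ∈ V z t', x ∈ b.txs) :
    LiveAfter online GST ℓ T input V := by
  intro x t hx z t' hz ht'
  obtain ⟨z₀, hz₀⟩ := hon (max GST t + ℓ)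
  have hdate := (hepoch.2 z₀ _ hz₀ _ rfl).2
  rcases hsafe.1 z₀ z _ t' hz₀ hz with h | h
  · obtain ⟨b, hb, hxb⟩ := hlive x t hx z₀ _ hz₀ le_rfl
    exact ⟨b, h.subset hb, hxb, hdate b hb⟩
  · obtain ⟨b, hb, hxb⟩ := hlive x t hx z t' hz ht'
    exact ⟨b, hb, hxb, hdate b (h.subset hb)⟩

/-- Some sets of consensus messages that are all broadcast by one time `t` confirm conflicting
ledgers, under the confirmation rule `C`.  `available t M` says that the messages of `M` have been
broadcast by time `t`. -/
def CertificateConflict {A X : Type} (available : ℕ → A → Prop) (C : A → List (Block X)) : Prop :=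
  ∃ (t : ℕ) (M₁ M₂ : A) (L₁ L₂ : List (Block X)), available t M₁ ∧ available t M₂ ∧
    L₁ <+: C M₁ ∧ L₂ <+: C M₂ ∧ ¬ Consistent L₁ L₂

/-- A protocol run with security parameter `ε` generates certificates: under the conditions
`cond` for its safety, the probability of a conflict is less than `ε`. -/
def GeneratesCertificates {Ω : Type} [MeasurableSpace Ω] (μ : MeasureTheory.Measure Ω)
    (ε : ENNReal) (cond conflict : Ω → Prop) : Prop :=
  μ {ω | cond ω ∧ conflict ω} < ε

/-! ### The omission-fault-tolerant protocol, as run by a smart contract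

An overlay block is identified with the chain that it defines (its last entry is the block itself,
the rest is reached through the parent pointers); the genesis block is `[]`. -/

/-- An overlay block, together with the chain that it extends. -/
abbrev OBlock (Tx : Type) := List (Block Tx)

/-- The epoch of an overlay block (`0` for the genesis block). -/
def OBlock.epochNo {Tx : Type} (B : OBlock Tx) : ℕ := (B.getLast?.map Block.epoch).getD 0

/-- The overlay messages: proposals, acknowledgements and leader-down messages.  A proposal needs
no separate ticket: messages travel with a certificate for the ledger on which the contract sent
them, and that ledger records the ticket. -/
inductive OMsg (Tx : Type)
  | prop (B : OBlock Tx) (v : ℕ)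
  | ack (B : OBlock Tx) (v : ℕ)
  | down (B : OBlock Tx) (v : ℕ)
  deriving DecidableEq

/-- Transactions of the underlay chains: overlay transactions of users; timers of the contract,
valid from underlay epoch `e` on; overlay messages sent by the contract on chain `src`, with a
certificate, i.e. a finite set of consensus messages of chain `src`. -/
inductive UTx (Tx : Type) (Msg : Fin 3 → Type)
  | user (x : Tx)
  | timer (e : ℕ)
  | recv (src : Fin 3) (m : OMsg Tx) (cert : Finset (Msg src))

/-- The state of the contract: the last overlay phase it has entered, the messages it has
observed (with their senders), the user transactions, and the messages it has sent. -/
structure CState (Tx : Type) where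
  phase : ℕ
  seen : List (Fin 3 × OMsg Tx)
  pool : List Tx
  sent : List (OMsg Tx)

/-- The round-robin leader of overlay epoch `v`. -/
def leader (v : ℕ) : Fin 3 := Fin.ofNat 3 v

/-- The transactions of `xs` that are not in `old`, without repetitions. -/
def fresh {Tx : Type} [DecidableEq Tx] (old xs : List Tx) : List Tx :=
  xs.foldl (fun a x => if x ∈ old ∨ x ∈ a then a else a ++ [x]) []

/-- The block with the maximal epoch number (the genesis block, if there is none). -/
def highest {Tx : Type} (Bs : List (OBlock Tx)) : OBlock Tx :=
  Bs.foldl (fun A B => if OBlock.epochNo A < OBlock.epochNo B then B else A) []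

section Contract

variable {Tx : Type} [DecidableEq Tx]

/-- The block is acknowledged for epoch `v` by at least two of the three emulated validators. -/
def isCertified (seen : List (Fin 3 × OMsg Tx)) (v : ℕ) (B : OBlock Tx) : Bool :=
  decide (2 ≤ (Finset.univ.filter fun i : Fin 3 => (i, OMsg.ack B v) ∈ seen).card)

/-- The blocks for which an epoch-`v` certificate has been observed.  The genesis block is
certified at epoch `0`. -/
def certifiedBlocks (seen : List (Fin 3 × OMsg Tx)) (v : ℕ) : List (OBlock Tx) :=
  (if v = 0 then [[]] else []) ++
    (seen.filterMap fun p => match p.2 with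
      | .ack B w => if w = v then some B else none
      | _ => none).filter (isCertified seen v)

/-- The leader-down messages observed for epoch `v`: sender and block. -/
def downs (seen : List (Fin 3 × OMsg Tx)) (v : ℕ) : List (Fin 3 × OBlock Tx) :=
  seen.filterMap fun p => match p.2 with
    | .down B w => if w = v then some (p.1, B) else none
    | _ => none

/-- The blocks proposed for epoch `v` by its leader, as far as observed. -/
def proposals (seen : List (Fin 3 × OMsg Tx)) (v : ℕ) : List (OBlock Tx) :=
  seen.filterMap fun p => match p.2 with
    | .prop B w => if w = v ∧ p.1 = leader v then some B else none
    | _ => none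

/-- The block that a leader with a ticket from epoch `v` extends in epoch `v + 1`; `none` if it
has no ticket. -/
def parent? (seen : List (Fin 3 × OMsg Tx)) (v : ℕ) : Option (OBlock Tx) :=
  match certifiedBlocks seen v with
  | B :: _ => some B
  | [] =>
    if 2 ≤ ((downs seen v).map Prod.fst).toFinset.card then
      some (highest ((downs seen v).map Prod.snd))
    else none

/-- The blocks that the contract has acknowledged. -/
def acked (sent : List (OMsg Tx)) : List (OBlock Tx) :=
  sent.filterMap fun m => match m with
    | .ack B _ => some B
    | _ => none

/-- The messages that validator `k` sends when it enters overlay phase `q`, i.e. phase `q % 3` of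
overlay epoch `q / 3`: proposal of the leader, acknowledgements, leader-down message. -/
def actions (k : Fin 3) (q : ℕ) (s : CState Tx) : List (OMsg Tx) :=
  if q % 3 = 0 then
    if leader (q / 3) = k then
      match parent? s.seen (q / 3 - 1) with
      | some B => [.prop (B ++ [⟨q / 3, fresh (txsOf B) s.pool⟩]) (q / 3)]
      | none => []
    else []
  else if q % 3 = 1 then (proposals s.seen (q / 3)).map fun B => .ack B (q / 3)
  else if certifiedBlocks s.seen (q / 3) = [] then [.down (highest (acked s.sent)) (q / 3)]
  else []

/-- Record the transactions of an underlay block. -/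
def record {Msg : Fin 3 → Type} (b : Block (UTx Tx Msg)) (s : CState Tx) : CState Tx :=
  { s with
    seen := s.seen ++ b.txs.filterMap fun x => match x with
      | .recv src m _ => some (src, m)
      | _ => none
    pool := s.pool ++ b.txs.filterMap fun x => match x with
      | .user x => some x
      | _ => none }

/-- The contract on chain `k` executes a block.  Underlay epochs last `T`, overlay phases last
`Tc`; the date `b.epoch * T` of the block tells the phase.  The contract acts when the block is the
first one in a new phase. -/
def step {Msg : Fin 3 → Type} (k : Fin 3) (T Tc : ℕ) (s : CState Tx) (b : Block (UTx Tx Msg)) :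
    CState Tx :=
  let r := record b s
  let q := b.epoch * T / Tc
  if s.phase < q then
    { r with
      phase := q
      seen := r.seen ++ (actions k q r).map fun m => (k, m)
      sent := r.sent ++ actions k q r }
  else r

/-- The state of the contract on chain `k` after the execution of a ledger. -/
def run {Msg : Fin 3 → Type} (k : Fin 3) (T Tc : ℕ) (L : List (Block (UTx Tx Msg))) : CState Tx :=
  L.foldl (step k T Tc) ⟨0, [], [], []⟩

/-- The overlay blocks committed by the validator emulated on a ledger: the proposal of the
correct leader and a certificate have been observed. -/
def committed {Msg : Fin 3 → Type} (k : Fin 3) (T Tc : ℕ) (L : List (Block (UTx Tx Msg))) :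
    List (OBlock Tx) :=
  let seen := (run k T Tc L).seen
  seen.filterMap fun p => match p.2 with
    | .prop B v => if p.1 = leader v ∧ isCertified seen v B = true then some B else none
    | _ => none

/-! ### The client of the overlay protocol -/

/-- The blocks committed by at least two of the three emulated validators. -/
def acceptedBlocks (c : Fin 3 → List (OBlock Tx)) : List (OBlock Tx) :=
  (c 0 ++ c 1 ++ c 2).filter fun B =>
    decide (2 ≤ (Finset.univ.filter fun k : Fin 3 => B ∈ c k).card)

/-- Append accepted blocks, in the order of their epochs and each one after its prefix chain, to
the list `F` of the blocks finalized so far; blocks that are already there are not repeated. -/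
def extendBy (F Bs : List (OBlock Tx)) : List (OBlock Tx) :=
  (Bs.mergeSort fun B B' => decide (OBlock.epochNo B ≤ OBlock.epochNo B')).foldl
    (fun F B => F ++ B.inits.tail.filter fun A => decide (A ∉ F)) F

/-- The ledger of a sequence of finalized blocks: of each transaction only the first occurrence
is kept. -/
def sanitize (F : List (OBlock Tx)) : List (Block Tx) :=
  F.foldl (fun L B =>
    L ++ [⟨OBlock.epochNo B, fresh (txsOf L) ((B.getLast?.map Block.txs).getD [])⟩]) []

end Contract

/-! ### The composition -/

/-- The three underlay chains and the parameters of the composition: the confirmation rules, the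
durations of the underlay epochs, the duration of an overlay phase (the bound on the cross-chain
latency that the overlay uses in place of a network delay) and the network delay after `GST`. -/
structure Setup (Tx : Type) (Msg : Fin 3 → Type) where
  confirm : (k : Fin 3) → Finset (Msg k) → List (Block (UTx Tx Msg))
  T : Fin 3 → ℕ
  Tc : ℕ
  Δ : ℕ
  T_pos : ∀ k, 0 < T k
  Tc_pos : 0 < Tc

namespace Setup

variable {Tx : Type} [DecidableEq Tx] {Msg : Fin 3 → Type}

/-- The certificate `M` proves that the contract on chain `k` has sent `m`: a valid prefix of the
ledger confirmed by `M` makes the contract send `m`. -/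
inductive Verified (P : Setup Tx Msg) : (k : Fin 3) → OMsg Tx → Finset (Msg k) → Prop
  | intro (k : Fin 3) (m : OMsg Tx) (M : Finset (Msg k)) (L : List (Block (UTx Tx Msg)))
      (isPrefix : L <+: P.confirm k M)
      (timers : ∀ b ∈ L, ∀ e, UTx.timer e ∈ b.txs → e ≤ b.epoch)
      (certs : ∀ b ∈ L, ∀ l m' (M' : Finset (Msg l)), UTx.recv l m' M' ∈ b.txs →
        Verified P l m' M')
      (sent : m ∈ (run k (P.T k) P.Tc L).sent) : Verified P k m M

/-- A block is valid if no timer in it is early and all certificates in it are correct. -/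
def BlockValid (P : Setup Tx Msg) (b : Block (UTx Tx Msg)) : Prop :=
  (∀ e, UTx.timer e ∈ b.txs → e ≤ b.epoch) ∧
  (∀ l m (M : Finset (Msg l)), UTx.recv l m M ∈ b.txs → P.Verified l m M)

open Classical in
/-- The ledger of chain `k` confirmed by a set of messages; everything from the first invalid
block on is discarded. -/
noncomputable def ledgerOf (P : Setup Tx Msg) (k : Fin 3) (M : Finset (Msg k)) :
    List (Block (UTx Tx Msg)) :=
  (P.confirm k M).takeWhile fun b => decide (P.BlockValid b)

/-- The transaction may be included in chain `k` from time `t` on. -/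
def TxValid (P : Setup Tx Msg) (k : Fin 3) (t : ℕ) : UTx Tx Msg → Prop
  | .user _ => True
  | .timer e => e * P.T k ≤ t
  | .recv l m M => P.Verified l m M

/-- The confirmation rule of the overlay protocol: the ledger of a client that knows the consensus
messages `M k` of the chains `k`. -/
noncomputable def overlayLedgerOf (P : Setup Tx Msg) (M : (k : Fin 3) → Finset (Msg k)) :
    List (Block Tx) :=
  sanitize (extendBy [] (acceptedBlocks fun k =>
    committed k (P.T k) P.Tc (P.ledgerOf k (M k))))

end Setup

/-- An execution of the composition under partial synchrony.  The clients are all parties that run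
clients of the three chains, among them the honest validators of the chains (always online) and
the parties that verify the certificates of cross-chain messages.
* `online z t`: client `z` is online at time `t` and follows all chains.
* `verifying z t`: at time `t`, `z` finalizes ledgers on the strength of the certificates that it
  has been shown, without being online.  Such clients matter for the safety of a chain, but nobody
  promises them its latest blocks.
* `GST` is the global stabilization time.
* `broadcast k t` are the consensus messages of chain `k` broadcast by time `t`, and `view z k t`
  are those that client `z` uses at time `t`.
* `input k x t`: transaction `x` has been input to all honest validators of chain `k` at time
  `t`.

Nothing is assumed on how the chains work internally, nor on the adversary. -/
structure Execution {Tx : Type} [DecidableEq Tx] {Msg : Fin 3 → Type} (P : Setup Tx Msg) where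
  Client : Type
  online : Client → ℕ → Prop
  verifying : Client → ℕ → Prop
  validator : Client → Prop
  GST : ℕ
  broadcast : (k : Fin 3) → ℕ → Set (Msg k)
  view : Client → (k : Fin 3) → ℕ → Finset (Msg k)
  input : Fin 3 → UTx Tx Msg → ℕ → Prop
  exists_validator : ∃ z, validator z
  validator_online : ∀ z t, validator z → online z t
  broadcast_mono : ∀ k t t', t ≤ t' → broadcast k t ⊆ broadcast k t'
  view_subset : ∀ z k t, (view z k t : Set (Msg k)) ⊆ broadcast k t
  /-- Cross-chain reads give access to finalized ledgers only: the ledger confirmed by a correct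
  certificate that is recorded on a chain is part of the ledger that some client of the source
  chain has finalized. -/
  certificate_read : ∀ (k : Fin 3) (t : ℕ) (M : Finset (Msg k)), (M : Set (Msg k)) ⊆ broadcast k t →
    ∀ b ∈ P.ledgerOf k M, ∀ l m (M' : Finset (Msg l)), UTx.recv l m M' ∈ b.txs →
      ∃ z s, s ≤ t ∧ (online z s ∨ verifying z s) ∧ P.ledgerOf l M' <+: P.ledgerOf l (view z l s)
  /-- Cross-chain writes: an overlay message that an honest validator observes on a ledger, where
  it is either sent by the contract or recorded, is input with a correct certificate to all
  chains, with at most the network delay. -/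
  relay : ∀ z s, validator z → ∀ (k : Fin 3) (m : OMsg Tx),
    (m ∈ (run k (P.T k) P.Tc (P.ledgerOf k (view z k s))).sent ∨
      ∃ j, ∃ b ∈ P.ledgerOf j (view z j s), ∃ M : Finset (Msg k), UTx.recv k m M ∈ b.txs) →
    ∀ l, ∃ (M : Finset (Msg k)) (t : ℕ), t ≤ max GST s + P.Δ ∧ P.Verified k m M ∧
      input l (UTx.recv k m M) t
  /-- The honest validators of a chain submit the timer of an epoch when the epoch starts. -/
  timers : ∀ k e, input k (UTx.timer e) (e * P.T k)

namespace Execution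

variable {Tx : Type} [DecidableEq Tx] {Msg : Fin 3 → Type} {P : Setup Tx Msg}

/-- The times at which a client finalizes ledgers of the three chains. -/
def active (X : Execution P) (z : X.Client) (t : ℕ) : Prop := X.online z t ∨ X.verifying z t

/-- The ledger of chain `k` output by client `z` at time `t`. -/
noncomputable def ledger (X : Execution P) (k : Fin 3) (z : X.Client) (t : ℕ) :
    List (Block (UTx Tx Msg)) :=
  P.ledgerOf k (X.view z k t)

/-- Chain `k` is safe. -/
def UnderlaySafe (X : Execution P) (k : Fin 3) : Prop := Safe X.active (X.ledger k)

/-- Chain `k` is live after `GST` with latency `ℓ`. -/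
def UnderlayLive (X : Execution P) (k : Fin 3) (ℓ : ℕ) : Prop :=
  LiveAfter X.online X.GST ℓ (P.T k) (fun x t => X.input k x t ∧ P.TxValid k t x) (X.ledger k)

/-- All three chains proceed in epochs of fixed duration. -/
def UnderlaysInEpochs (X : Execution P) : Prop :=
  ∀ k, ProceedsInEpochs X.active (P.T k) fun z t => {X.ledger k z t}

/-- Sets of messages of chain `k` confirm conflicting ledgers. -/
def UnderlayConflict (X : Execution P) (k : Fin 3) : Prop :=
  CertificateConflict (fun t (M : Finset (Msg k)) => (M : Set (Msg k)) ⊆ X.broadcast k t)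
    (P.ledgerOf k)

open Classical in
/-- The overlay blocks committed by the validators emulated on chain `k`, on all ledgers of the
chain that client `z` has observed by time `t`. -/
noncomputable def commits (X : Execution P) (z : X.Client) (t : ℕ) (k : Fin 3) :
    List (OBlock Tx) :=
  (List.range (t + 1)).flatMap fun s =>
    if X.online z s then committed k (P.T k) P.Tc (X.ledger k z s) else []

/-- The overlay blocks accepted by client `z` at time `t`. -/
noncomputable def accepted (X : Execution P) (z : X.Client) (t : ℕ) : List (OBlock Tx) :=
  acceptedBlocks (X.commits z t)

/-- The overlay blocks finalized by client `z` by time `t`, in the order of finalization. -/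
noncomputable def finalized (X : Execution P) (z : X.Client) : ℕ → List (OBlock Tx)
  | 0 => extendBy [] (X.accepted z 0)
  | t + 1 => extendBy (X.finalized z t) (X.accepted z (t + 1))

/-- The overlay ledger output by client `z` at time `t`. -/
noncomputable def overlayLedger (X : Execution P) (z : X.Client) (t : ℕ) : List (Block Tx) :=
  sanitize (X.finalized z t)

/-- The composition is safe. -/
def OverlaySafe (X : Execution P) : Prop := Safe X.online X.overlayLedger

/-- The composition is live after `GST` with latency `ℓ`; its input is the input to all honest
validators of all chains. -/
def OverlayLive (X : Execution P) (ℓ : ℕ) : Prop :=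
  LiveAfter X.online X.GST ℓ (3 * P.Tc) (fun x t => ∀ k, X.input k (UTx.user x) t) X.overlayLedger

/-- Sets of messages of the three chains confirm conflicting overlay ledgers. -/
def OverlayConflict (X : Execution P) : Prop :=
  CertificateConflict
    (fun t (M : (k : Fin 3) → Finset (Msg k)) => ∀ k, (M k : Set (Msg k)) ⊆ X.broadcast k t)
    P.overlayLedgerOf

end Execution

/-! Contracts are studied through their actions. A contract acts at most once per phase, in the
order of the phases, and a message is on a ledger's list of sent messages exactly if one of these
actions sends it (`mem_run_sent`). Proposals of epoch `v` belong to phase `3 * v`, acknowledgements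
to `3 * v + 1`, leader-down messages to `3 * v + 2`.

Safety is a quorum-intersection argument as in Paxos, carried out for a family of ledgers that is
closed under reads: whatever one ledger records has been sent on another. If the ledgers of each
chain are also consistent, each chain acts like one validator that may omit messages but never lies
or equivocates. `FamilyConsistent.prefix_of_prop` shows by induction on `w` that a proposal of epoch
`w` extends every block certified in an epoch `v ≤ w`. If the leader used two leader-down messages,
one of their senders is among the two that acknowledged the certified block, so the highest reported
block has epoch at least `v` and the induction hypothesis applies to it. Hence all committed blocks
lie on one chain. With the finalized ledgers as family this gives safety. With all ledgers confirmed
by broadcast messages it shows that an overlay conflict forces a conflict on some underlay chain,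
and a union bound gives certificates.

Liveness uses no safety. `KnownBefore` speaks of all ledgers that online clients see on live chains,
so forks do no harm. After `GST` a live chain acts in each phase, and what it knows or sends is
known on all live chains before the next one (`exists_action`). Two live chains form a quorum: each
epoch ends with a certificate or two leader-down messages (`exists_ticket`), so a live leader can
propose, and both acknowledge. One of any two consecutive leaders is live. Forks may still make a
client accept conflicting blocks; `exists_prefix_finalized` bounds the dates of those placed ahead
of the wanted one.

The epoch structure follows from the phase in which a proposal is sent, and for accepted chains
needs no consistency either. -/

set_option linter.unusedSectionVars false

/-! ### The history of the contract -/

section History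

variable {Tx : Type} [DecidableEq Tx] {Msg : Fin 3 → Type} {k : Fin 3} {T Tc : ℕ}

/-- The contract on chain `k` enters phase `q` on the ledger `L`, and acts in state `r`. -/
def ActsAt (k : Fin 3) (T Tc : ℕ) (L : List (Block (UTx Tx Msg))) (q : ℕ) (r : CState Tx) : Prop :=
  ∃ L₁ b, L₁ ++ [b] <+: L ∧ b.epoch * T / Tc = q ∧ (run k T Tc L₁).phase < q ∧
    r = record b (run k T Tc L₁)

/-- The overlay message `m` from chain `a` is recorded on the ledger `L`. -/
def Recorded (L : List (Block (UTx Tx Msg))) (a : Fin 3) (m : OMsg Tx) : Prop :=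
  ∃ b ∈ L, ∃ M : Finset (Msg a), UTx.recv a m M ∈ b.txs

theorem Recorded.mono {L L' : List (Block (UTx Tx Msg))} {a : Fin 3} {m : OMsg Tx}
    (h : Recorded L a m) (hL : L ⊆ L') : Recorded L' a m := by
  obtain ⟨b, hb, M, hM⟩ := h
  exact ⟨b, hL hb, M, hM⟩

theorem run_concat (L : List (Block (UTx Tx Msg))) (b : Block (UTx Tx Msg)) :
    run k T Tc (L ++ [b]) = step k T Tc (run k T Tc L) b := by
  simp [run]

theorem step_phase (s : CState Tx) (b : Block (UTx Tx Msg)) :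
    (step k T Tc s b).phase = max s.phase (b.epoch * T / Tc) := by
  simp only [step]
  split_ifs with h
  · simp [h.le]
  · simp only [record]; omega

theorem step_sent (s : CState Tx) (b : Block (UTx Tx Msg)) :
    (step k T Tc s b).sent = s.sent ++
      if s.phase < b.epoch * T / Tc then actions k (b.epoch * T / Tc) (record b s) else [] := by
  simp only [step]
  split_ifs <;> simp [record]

theorem step_seen (s : CState Tx) (b : Block (UTx Tx Msg)) :
    (step k T Tc s b).seen = (record b s).seen ++
      (if s.phase < b.epoch * T / Tc then actions k (b.epoch * T / Tc) (record b s) else []).map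
        fun m => (k, m) := by
  simp only [step]
  split_ifs <;> simp [record]

theorem mem_record_seen {s : CState Tx} {b : Block (UTx Tx Msg)} {a : Fin 3} {m : OMsg Tx} :
    (a, m) ∈ (record b s).seen ↔
      (a, m) ∈ s.seen ∨ ∃ M : Finset (Msg a), UTx.recv a m M ∈ b.txs := by
  simp only [record, List.mem_append, List.mem_filterMap]
  refine or_congr_right ⟨?_, ?_⟩
  · rintro ⟨x, hx, h⟩
    cases x <;> simp at h
    obtain ⟨rfl, rfl⟩ := h
    exact ⟨_, hx⟩
  · rintro ⟨M, hM⟩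
    exact ⟨_, hM, rfl⟩

theorem mem_record_pool {s : CState Tx} {b : Block (UTx Tx Msg)} {x : Tx} :
    x ∈ (record b s).pool ↔ x ∈ s.pool ∨ UTx.user x ∈ b.txs := by
  simp only [record, List.mem_append, List.mem_filterMap]
  refine or_congr_right ⟨?_, ?_⟩
  · rintro ⟨y, hy, h⟩
    cases y <;> simp at h
    exact h ▸ hy
  · intro h
    exact ⟨_, h, rfl⟩

theorem step_pool (s : CState Tx) (b : Block (UTx Tx Msg)) :
    (step k T Tc s b).pool = (record b s).pool := by
  simp only [step]
  split_ifs <;> rfl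

/-- An invariant that each block preserves holds along every extension of a ledger. -/
theorem run_induction_of_prefix {L L' : List (Block (UTx Tx Msg))} (h : L <+: L')
    {p : CState Tx → Prop} (h0 : p (run k T Tc L))
    (hs : ∀ s (b : Block (UTx Tx Msg)), p s → p (step k T Tc s b)) :
    p (run k T Tc L') := by
  obtain ⟨D, rfl⟩ := h
  induction D using List.reverseRecOn with
  | nil => simpa using h0
  | append_singleton D b ih => rw [← List.append_assoc, run_concat]; exact hs _ _ ih

theorem run_phase_mono {L L' : List (Block (UTx Tx Msg))} (h : L <+: L') :
    (run k T Tc L).phase ≤ (run k T Tc L').phase :=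
  run_induction_of_prefix h (p := fun s => (run k T Tc L).phase ≤ s.phase) le_rfl
    fun s b hs => by rw [step_phase]; exact hs.trans (le_max_left _ _)

theorem run_sent_mono {L L' : List (Block (UTx Tx Msg))} (h : L <+: L') {m : OMsg Tx}
    (hm : m ∈ (run k T Tc L).sent) : m ∈ (run k T Tc L').sent :=
  run_induction_of_prefix h (p := fun s => m ∈ s.sent) hm
    fun s b hs => by rw [step_sent]; exact List.mem_append_left _ hs

theorem mem_run_pool {L : List (Block (UTx Tx Msg))} {x : Tx} :
    x ∈ (run k T Tc L).pool ↔ ∃ b ∈ L, UTx.user x ∈ b.txs := by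
  induction L using List.reverseRecOn with
  | nil => simp [run]
  | append_singleton L b ih =>
    rw [run_concat, step_pool, mem_record_pool, ih]
    simp [or_and_right, exists_or]

/-- A contract counts its own messages as observed at once, without a cross-chain read; everything
else must be recorded on its ledger. -/
theorem mem_run_seen {L : List (Block (UTx Tx Msg))} {a : Fin 3} {m : OMsg Tx} :
    (a, m) ∈ (run k T Tc L).seen ↔ Recorded L a m ∨ (a = k ∧ m ∈ (run k T Tc L).sent) := by
  induction L using List.reverseRecOn with
  | nil => simp [run, Recorded]
  | append_singleton L b ih =>
    have hrec : Recorded (L ++ [b]) a m ↔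
        Recorded L a m ∨ ∃ M : Finset (Msg a), UTx.recv a m M ∈ b.txs := by
      simp [Recorded, or_and_right, exists_or]
    rw [run_concat, step_seen, step_sent, List.mem_append, mem_record_seen, ih, hrec,
      List.mem_append, List.mem_map]
    simp only [Prod.mk.injEq]
    constructor
    · rintro (((h | h) | h) | ⟨m', h, rfl, rfl⟩)
      · exact .inl (.inl h)
      · exact .inr ⟨h.1, .inl h.2⟩
      · exact .inl (.inr h)
      · exact .inr ⟨rfl, .inr h⟩
    · rintro ((h | h) | ⟨rfl, h | h⟩)
      · exact .inl (.inl (.inl h))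
      · exact .inl (.inr h)
      · exact .inl (.inl (.inr ⟨rfl, h⟩))
      · exact .inr ⟨m, h, rfl, rfl⟩

theorem mem_run_sent {L : List (Block (UTx Tx Msg))} {m : OMsg Tx} :
    m ∈ (run k T Tc L).sent ↔ ∃ q r, ActsAt k T Tc L q r ∧ m ∈ actions k q r := by
  constructor
  · induction L using List.reverseRecOn with
    | nil => simp [run]
    | append_singleton L b ih =>
      rw [run_concat, step_sent, List.mem_append]
      rintro (h | h)
      · obtain ⟨q, r, ⟨L₁, b', hp, h⟩, hm⟩ := ih h
        exact ⟨q, r, ⟨L₁, b', hp.trans (List.prefix_append _ _), h⟩, hm⟩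
      · split_ifs at h with hq
        · exact ⟨_, _, ⟨L, b, List.prefix_rfl, rfl, hq, rfl⟩, h⟩
        · simp at h
  · rintro ⟨q, r, ⟨L₁, b, hp, rfl, hq, rfl⟩, hm⟩
    refine run_sent_mono hp ?_
    rw [run_concat, step_sent, if_pos hq]
    exact List.mem_append_right _ hm

/-! ### Order and uniqueness of the actions of a contract -/

namespace ActsAt

variable {L L' : List (Block (UTx Tx Msg))} {q q' : ℕ} {r r' : CState Tx}

theorem mono (h : ActsAt k T Tc L q r) (hL : L <+: L') : ActsAt k T Tc L' q r := by
  obtain ⟨L₁, b, hp, h⟩ := h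
  exact ⟨L₁, b, hp.trans hL, h⟩

theorem pos (h : ActsAt k T Tc L q r) : 0 < q := by
  obtain ⟨L₁, b, hp, -, h, -⟩ := h
  omega

theorem exists_block (h : ActsAt k T Tc L q r) : ∃ b ∈ L, b.epoch * T / Tc = q := by
  obtain ⟨L₁, b, hp, h, -⟩ := h
  exact ⟨b, hp.subset (by simp), h⟩

theorem sent (h : ActsAt k T Tc L q r) {m : OMsg Tx} (hm : m ∈ actions k q r) :
    m ∈ (run k T Tc L).sent :=
  mem_run_sent.2 ⟨q, r, h, hm⟩

theorem phase_le (h : ActsAt k T Tc L q r) : q ≤ (run k T Tc L).phase := by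
  obtain ⟨L₁, b, hp, rfl, -⟩ := h
  refine le_trans ?_ (run_phase_mono hp)
  rw [run_concat, step_phase]
  exact le_max_right _ _

/-- The phase counter never decreases, so actions of smaller phases are exactly those that precede
on the ledger. A leader-down message therefore takes all earlier acknowledgements into account. -/
theorem mem_sent_iff (h : ActsAt k T Tc L q r) {m : OMsg Tx} :
    m ∈ r.sent ↔ ∃ q' < q, ∃ r', ActsAt k T Tc L q' r' ∧ m ∈ actions k q' r' := by
  obtain ⟨L₁, b, hp, rfl, hq, rfl⟩ := h
  have hp₁ : L₁ <+: L := (List.prefix_append _ _).trans hp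
  change m ∈ (run k T Tc L₁).sent ↔ _
  rw [mem_run_sent]
  constructor
  · rintro ⟨q', r', h', hm⟩
    exact ⟨q', h'.phase_le.trans_lt hq, r', h'.mono hp₁, hm⟩
  · rintro ⟨q', hlt, r', ⟨L₂, b', hp', rfl, hq', rfl⟩, hm⟩
    refine ⟨_, _, ⟨L₂, b', ?_, rfl, hq', rfl⟩, hm⟩
    rcases List.prefix_or_prefix_of_prefix hp' hp with h | h
    · rcases List.prefix_concat_iff.1 h with h | h
      · obtain ⟨rfl, hb⟩ := List.append_inj' h rfl
        simp only [List.cons.injEq, and_true] at hb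
        subst hb
        omega
      · exact h
    · exfalso
      rcases List.prefix_concat_iff.1 h with h | h
      · obtain ⟨rfl, hb⟩ := List.append_inj' h rfl
        simp only [List.cons.injEq, and_true] at hb
        subst hb
        omega
      · have := run_phase_mono (k := k) (T := T) (Tc := Tc) h
        rw [run_concat, step_phase] at this
        omega

/-- Entering phase `q` raises the counter to at least `q`, so it is entered once. This excludes
equivocation on a single ledger. -/
theorem unique (h : ActsAt k T Tc L q r) (h' : ActsAt k T Tc L q r') : r = r' := by
  obtain ⟨L₁, b, hp, hb, hq, rfl⟩ := h
  obtain ⟨L₂, b', hp', hb', hq', rfl⟩ := h'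
  have key : ∀ (L₁ L₂ : List (Block (UTx Tx Msg))) (b b' : Block (UTx Tx Msg)),
      b.epoch * T / Tc = q → (run k T Tc L₂).phase < q → L₁ ++ [b] <+: L₂ ++ [b'] →
        record b (run k T Tc L₁) = record b' (run k T Tc L₂) := by
    intro L₁ L₂ b b' hb hq h
    rcases List.prefix_concat_iff.1 h with h | h
    · obtain ⟨rfl, hbb⟩ := List.append_inj' h rfl
      simp only [List.cons.injEq, and_true] at hbb
      rw [hbb]
    · have := run_phase_mono (k := k) (T := T) (Tc := Tc) h
      rw [run_concat, step_phase] at this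
      omega
  rcases List.prefix_or_prefix_of_prefix hp hp' with h | h
  · exact key _ _ _ _ hb hq' h
  · exact (key _ _ _ _ hb' hq h).symm

theorem seen_or (h : ActsAt k T Tc L q r) {a : Fin 3} {m : OMsg Tx} (hm : (a, m) ∈ r.seen) :
    Recorded L a m ∨ (a = k ∧ m ∈ (run k T Tc L).sent) := by
  obtain ⟨L₁, b, hp, -, -, rfl⟩ := h
  have hp₁ : L₁ <+: L := (List.prefix_append _ _).trans hp
  rcases mem_record_seen.1 hm with h | ⟨M, hM⟩
  · rcases mem_run_seen.1 h with h | ⟨rfl, h⟩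
    · exact .inl (h.mono hp₁.subset)
    · exact .inr ⟨rfl, run_sent_mono hp₁ h⟩
  · exact .inl ⟨b, hp.subset (by simp), M, hM⟩

/-- The contract acts in a phase as soon as the ledger has a block of that phase, and it knows
what earlier blocks record. -/
theorem exists_of_mem (hL : L.Pairwise fun b b' => b.epoch < b'.epoch) (hq : 0 < q)
    {b : Block (UTx Tx Msg)} (hb : b ∈ L) (hbq : b.epoch * T / Tc = q) :
    ∃ r, ActsAt k T Tc L q r ∧ ∀ b' ∈ L, b'.epoch * T / Tc < q →
      (∀ a m (M : Finset (Msg a)), UTx.recv a m M ∈ b'.txs → (a, m) ∈ r.seen) ∧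
      ∀ x, UTx.user x ∈ b'.txs → x ∈ r.pool := by
  induction L using List.reverseRecOn generalizing b with
  | nil => simp at hb
  | append_singleton L c ih =>
    rw [List.pairwise_append] at hL
    obtain ⟨hL, -, hLc⟩ := hL
    -- The first block of phase `q` triggers the action. If it lies in `L`, the last block `c` has
    -- phase at least `q` and adds nothing to what must be known.
    by_cases hex : ∃ b ∈ L, b.epoch * T / Tc = q
    · obtain ⟨b₀, hb₀, hbq₀⟩ := hex
      obtain ⟨r, hr, hk⟩ := ih hL hb₀ hbq₀
      refine ⟨r, hr.mono (List.prefix_append _ _), fun b' hb' hlt => ?_⟩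
      rcases List.mem_append.1 hb' with h | h
      · exact hk b' h hlt
      · exfalso
        have h1 := hLc _ hb₀ b' h
        have h2 : b₀.epoch * T / Tc ≤ b'.epoch * T / Tc :=
          Nat.div_le_div_right (Nat.mul_le_mul_right _ h1.le)
        omega
    · have hcb : c = b := by
        rcases List.mem_append.1 hb with h | h
        · exact absurd ⟨b, h, hbq⟩ hex
        · exact (List.mem_singleton.1 h).symm
      subst hcb
      -- Epochs increase and `L` has no block of phase `q`, so all its blocks are of lower phases.
      -- The counter starts at `0`, hence the condition `0 < q`.
      have hph : (run k T Tc L).phase < q := by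
        have : ∀ L' : List (Block (UTx Tx Msg)), (∀ b ∈ L', b.epoch * T / Tc < q) →
            (run k T Tc L').phase < q := by
          intro L' h
          induction L' using List.reverseRecOn with
          | nil => exact hq
          | append_singleton L' d ih' =>
            rw [run_concat, step_phase]
            exact max_lt (ih' fun b hb => h b (by simp [hb])) (h d (by simp))
        refine this L fun b hb => lt_of_le_of_ne ?_ fun h => hex ⟨b, hb, h⟩
        rw [← hbq]
        exact Nat.div_le_div_right (Nat.mul_le_mul_right _ (hLc b hb c (by simp)).le)
      refine ⟨_, ⟨L, c, List.prefix_rfl, hbq, hph, rfl⟩, fun b' hb' hlt => ?_⟩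
      rcases List.mem_append.1 hb' with h | h
      · exact ⟨fun a m M hM => mem_record_seen.2 (.inl (mem_run_seen.2 (.inl ⟨b', h, M, hM⟩))),
          fun x hx => mem_record_pool.2 (.inl (mem_run_pool.2 ⟨b', h, hx⟩))⟩
      · rw [List.mem_singleton.1 h] at hlt
        omega

end ActsAt

end History

/-! ### What the contract sends -/

section Actions

variable {Tx : Type} [DecidableEq Tx] {k : Fin 3} {q v : ℕ} {r : CState Tx} {B : OBlock Tx}

theorem isCertified_iff {seen : List (Fin 3 × OMsg Tx)} :
    isCertified seen v B = true ↔
      ∃ Q : Finset (Fin 3), 2 ≤ Q.card ∧ ∀ a ∈ Q, (a, OMsg.ack B v) ∈ seen := by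
  rw [isCertified, decide_eq_true_iff]
  constructor
  · intro h
    exact ⟨_, h, fun a ha => (Finset.mem_filter.1 ha).2⟩
  · rintro ⟨Q, hQ, h⟩
    exact hQ.trans (Finset.card_le_card fun a ha => Finset.mem_filter.2 ⟨Finset.mem_univ _, h a ha⟩)

theorem mem_certifiedBlocks {seen : List (Fin 3 × OMsg Tx)} :
    B ∈ certifiedBlocks seen v ↔ (v = 0 ∧ B = []) ∨ isCertified seen v B = true := by
  rw [certifiedBlocks, List.mem_append, List.mem_filter]
  constructor
  · rintro (h | h)
    · split_ifs at h with hv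
      · exact .inl ⟨hv, List.mem_singleton.1 h⟩
      · simp at h
    · exact .inr h.2
  · rintro (⟨rfl, rfl⟩ | h)
    · simp
    · refine .inr ⟨?_, h⟩
      obtain ⟨Q, hQ, hs⟩ := isCertified_iff.1 h
      obtain ⟨a, ha⟩ := Finset.card_pos.1 (by omega : 0 < Q.card)
      exact List.mem_filterMap.2 ⟨_, hs a ha, by simp⟩

theorem mem_downs {seen : List (Fin 3 × OMsg Tx)} {a : Fin 3} :
    (a, B) ∈ downs seen v ↔ (a, OMsg.down B v) ∈ seen := by
  rw [downs, List.mem_filterMap]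
  constructor
  · rintro ⟨⟨a', m⟩, hp, h⟩
    cases m <;> simp at h
    obtain ⟨rfl, rfl, rfl⟩ := h
    exact hp
  · intro h
    exact ⟨_, h, by simp⟩

theorem mem_proposals {seen : List (Fin 3 × OMsg Tx)} :
    B ∈ proposals seen v ↔ (leader v, OMsg.prop B v) ∈ seen := by
  rw [proposals, List.mem_filterMap]
  constructor
  · rintro ⟨⟨a', m⟩, hp, h⟩
    cases m <;> simp at h
    obtain ⟨⟨rfl, rfl⟩, rfl⟩ := h
    exact hp
  · intro h
    exact ⟨_, h, by simp⟩

theorem mem_acked {sent : List (OMsg Tx)} : B ∈ acked sent ↔ ∃ v, OMsg.ack B v ∈ sent := by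
  rw [acked, List.mem_filterMap]
  constructor
  · rintro ⟨m, hp, h⟩
    cases m <;> simp at h
    exact ⟨_, h ▸ hp⟩
  · rintro ⟨v, h⟩
    exact ⟨_, h, rfl⟩

theorem highest_concat (Bs : List (OBlock Tx)) (B : OBlock Tx) :
    highest (Bs ++ [B]) = if OBlock.epochNo (highest Bs) < OBlock.epochNo B then B
      else highest Bs := by
  rw [highest, List.foldl_append]
  rfl

theorem highest_eq_nil_or_mem (Bs : List (OBlock Tx)) : highest Bs = [] ∨ highest Bs ∈ Bs := by
  induction Bs using List.reverseRecOn with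
  | nil => simp [highest]
  | append_singleton Bs B ih =>
    rw [highest_concat]
    split_ifs
    · simp
    · exact ih.imp_right fun h => List.mem_append_left _ h

theorem epochNo_le_highest {Bs : List (OBlock Tx)} (hB : B ∈ Bs) :
    OBlock.epochNo B ≤ OBlock.epochNo (highest Bs) := by
  induction Bs using List.reverseRecOn with
  | nil => simp at hB
  | append_singleton Bs C ih =>
    rw [highest_concat]
    rcases List.mem_append.1 hB with h | h
    · have := ih h
      split_ifs <;> omega
    · rw [List.mem_singleton.1 h]
      split_ifs <;> omega

/-- The reasons for which a leader may extend the block `B` after epoch `v`. -/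
theorem parent?_eq_some {seen : List (Fin 3 × OMsg Tx)} (h : parent? seen v = some B) :
    (v = 0 ∧ B = []) ∨ isCertified seen v B = true ∨
      2 ≤ ((downs seen v).map Prod.fst).toFinset.card ∧
        B = highest ((downs seen v).map Prod.snd) := by
  unfold parent? at h
  split at h
  · rename_i C _ hC
    have : B ∈ certifiedBlocks seen v := by
      rw [hC]; simp_all
    exact (mem_certifiedBlocks.1 this).imp_right .inl
  · split_ifs at h with hc
    exact .inr (.inr ⟨hc, (Option.some.inj h).symm⟩)

theorem parent?_of_certified {seen : List (Fin 3 × OMsg Tx)} (h : isCertified seen v B = true) :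
    ∃ A, parent? seen v = some A := by
  have : B ∈ certifiedBlocks seen v := mem_certifiedBlocks.2 (.inr h)
  unfold parent?
  split
  · exact ⟨_, rfl⟩
  · simp_all

theorem parent?_of_downs {seen : List (Fin 3 × OMsg Tx)} {a a' : Fin 3} (haa : a ≠ a')
    {A A' : OBlock Tx} (h : (a, OMsg.down A v) ∈ seen) (h' : (a', OMsg.down A' v) ∈ seen) :
    ∃ C, parent? seen v = some C := by
  unfold parent?
  split
  · exact ⟨_, rfl⟩
  · rw [if_pos]
    · exact ⟨_, rfl⟩
    · rw [← Finset.card_pair haa]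
      refine Finset.card_le_card fun c hc => ?_
      rw [List.mem_toFinset, List.mem_map]
      rcases Finset.mem_insert.1 hc with rfl | hc
      · exact ⟨_, mem_downs.2 h, rfl⟩
      · rw [Finset.mem_singleton.1 hc]
        exact ⟨_, mem_downs.2 h', rfl⟩

theorem prop_mem_actions : OMsg.prop B v ∈ actions k q r ↔
    q = 3 * v ∧ leader v = k ∧ ∃ A, parent? r.seen (v - 1) = some A ∧
      B = A ++ [⟨v, fresh (txsOf A) r.pool⟩] := by
  constructor
  · intro h
    unfold actions at h
    split_ifs at h with h0 h1 h2 h3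
    · split at h
      · rename_i A hA
        simp only [List.mem_singleton, OMsg.prop.injEq] at h
        obtain ⟨hB, hv⟩ := h
        rw [← hv] at h1 hA hB
        exact ⟨by omega, h1, A, hA, hB⟩
      · simp at h
    all_goals simp at h
  · rintro ⟨rfl, hk, A, hA, rfl⟩
    have h1 : 3 * v / 3 = v := by omega
    simp [actions, h1, hk, hA]

theorem ack_mem_actions : OMsg.ack B v ∈ actions k q r ↔
    q = 3 * v + 1 ∧ (leader v, OMsg.prop B v) ∈ r.seen := by
  rw [← mem_proposals]
  constructor
  · intro h
    unfold actions at h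
    split_ifs at h with h0 h1 h2 h3
    · split at h <;> simp at h
    · simp at h
    · simp only [List.mem_map, OMsg.ack.injEq] at h
      obtain ⟨A, hA, rfl, rfl⟩ := h
      exact ⟨by omega, hA⟩
    all_goals simp at h
  · rintro ⟨rfl, h⟩
    have h1 : (3 * v + 1) / 3 = v := by omega
    simp [actions, h1, h]

theorem down_mem_actions : OMsg.down B v ∈ actions k q r ↔
    q = 3 * v + 2 ∧ certifiedBlocks r.seen v = [] ∧ B = highest (acked r.sent) := by
  constructor
  · intro h
    unfold actions at h
    split_ifs at h with h0 h1 h2 h3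
    · split at h <;> simp at h
    · simp at h
    · simp at h
    · simp only [List.mem_singleton, OMsg.down.injEq] at h
      obtain ⟨hB, hv⟩ := h
      rw [← hv] at h3
      exact ⟨by omega, h3, hB⟩
    · simp at h
  · rintro ⟨rfl, h, rfl⟩
    have h1 : (3 * v + 2) / 3 = v := by omega
    have h2 : (3 * v + 2) % 3 = 2 := by omega
    simp [actions, h1, h2, h]

theorem mem_committed {Msg : Fin 3 → Type} {T Tc : ℕ} {L : List (Block (UTx Tx Msg))} :
    B ∈ committed k T Tc L ↔ ∃ v, (leader v, OMsg.prop B v) ∈ (run k T Tc L).seen ∧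
      isCertified (run k T Tc L).seen v B = true := by
  simp only [committed, List.mem_filterMap]
  constructor
  · rintro ⟨⟨a, m⟩, hp, h⟩
    cases m <;> simp at h
    obtain ⟨⟨rfl, h⟩, rfl⟩ := h
    exact ⟨_, hp, h⟩
  · rintro ⟨v, hp, h⟩
    exact ⟨_, hp, by simp [h]⟩

end Actions

/-! ### Families of ledgers -/

section Family

variable {Tx : Type} [DecidableEq Tx] {Msg : Fin 3 → Type} {P : Setup Tx Msg}
  {𝓛 : Fin 3 → Set (List (Block (UTx Tx Msg)))}

/-- The contract on chain `k` sends `m` on some ledger of the family. -/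
def SentIn (P : Setup Tx Msg) (𝓛 : Fin 3 → Set (List (Block (UTx Tx Msg)))) (k : Fin 3)
    (m : OMsg Tx) : Prop :=
  ∃ L ∈ 𝓛 k, m ∈ (run k (P.T k) P.Tc L).sent

/-- What is recorded on a ledger of the family is sent on a ledger of the family. -/
def ClosedUnderReads (P : Setup Tx Msg) (𝓛 : Fin 3 → Set (List (Block (UTx Tx Msg)))) : Prop :=
  ∀ k, ∀ L ∈ 𝓛 k, ∀ a m, Recorded L a m → SentIn P 𝓛 a m

/-- The block `B` has a certificate of epoch `v`. -/
def CertifiedIn (P : Setup Tx Msg) (𝓛 : Fin 3 → Set (List (Block (UTx Tx Msg)))) (B : OBlock Tx)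
    (v : ℕ) : Prop :=
  ∃ Q : Finset (Fin 3), 2 ≤ Q.card ∧ ∀ a ∈ Q, SentIn P 𝓛 a (.ack B v)

theorem OBlock.epochNo_concat (A : OBlock Tx) (b : Block Tx) :
    OBlock.epochNo (A ++ [b]) = b.epoch := by
  simp [OBlock.epochNo]

namespace ClosedUnderReads

variable {k : Fin 3} {v : ℕ} {B : OBlock Tx} {L : List (Block (UTx Tx Msg))}

theorem sent_of_seen (h : ClosedUnderReads P 𝓛) (hL : L ∈ 𝓛 k) {a : Fin 3} {m : OMsg Tx}
    (hm : (a, m) ∈ (run k (P.T k) P.Tc L).seen) : SentIn P 𝓛 a m := by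
  rcases mem_run_seen.1 hm with hm | ⟨rfl, hm⟩
  · exact h k L hL a m hm
  · exact ⟨L, hL, hm⟩

theorem sent_of_actsAt (h : ClosedUnderReads P 𝓛) (hL : L ∈ 𝓛 k) {q : ℕ} {r : CState Tx}
    (hr : ActsAt k (P.T k) P.Tc L q r) {a : Fin 3} {m : OMsg Tx} (hm : (a, m) ∈ r.seen) :
    SentIn P 𝓛 a m := by
  rcases hr.seen_or hm with hm | ⟨rfl, hm⟩
  · exact h k L hL a m hm
  · exact ⟨L, hL, hm⟩

/-- Links acknowledgements back to proposals, so that inductions over proposals can pass through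
certificates and leader-down messages. -/
theorem prop_of_ack (h : ClosedUnderReads P 𝓛) (hs : SentIn P 𝓛 k (.ack B v)) :
    SentIn P 𝓛 (leader v) (.prop B v) := by
  obtain ⟨L, hL, hm⟩ := hs
  obtain ⟨q, r, hr, hm⟩ := mem_run_sent.1 hm
  exact h.sent_of_actsAt hL hr (ack_mem_actions.1 hm).2

theorem certifiedIn_of_actsAt (h : ClosedUnderReads P 𝓛) (hL : L ∈ 𝓛 k) {q : ℕ} {r : CState Tx}
    (hr : ActsAt k (P.T k) P.Tc L q r) (hc : isCertified r.seen v B = true) :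
    CertifiedIn P 𝓛 B v := by
  obtain ⟨Q, hQ, hs⟩ := isCertified_iff.1 hc
  exact ⟨Q, hQ, fun a ha => h.sent_of_actsAt hL hr (hs a ha)⟩

theorem certifiedIn_of_committed (h : ClosedUnderReads P 𝓛) (hL : L ∈ 𝓛 k)
    (hB : B ∈ committed k (P.T k) P.Tc L) :
    ∃ v, SentIn P 𝓛 (leader v) (.prop B v) ∧ CertifiedIn P 𝓛 B v := by
  obtain ⟨v, hp, hc⟩ := mem_committed.1 hB
  obtain ⟨Q, hQ, hs⟩ := isCertified_iff.1 hc
  exact ⟨v, h.sent_of_seen hL hp, Q, hQ, fun a ha => h.sent_of_seen hL (hs a ha)⟩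

/-- The block in a leader-down message has been acknowledged. -/
theorem ack_of_down {A : OBlock Tx} (hs : SentIn P 𝓛 k (.down A v)) :
    A = [] ∨ ∃ w ≤ v, SentIn P 𝓛 k (.ack A w) := by
  obtain ⟨L, hL, hm⟩ := hs
  obtain ⟨q, r, hr, hm⟩ := mem_run_sent.1 hm
  obtain ⟨rfl, -, rfl⟩ := down_mem_actions.1 hm
  refine (highest_eq_nil_or_mem _).imp_right fun hA => ?_
  obtain ⟨w, hw⟩ := mem_acked.1 hA
  obtain ⟨q', hq', r', hr', hm'⟩ := hr.mem_sent_iff.1 hw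
  have := (ack_mem_actions.1 hm').1
  exact ⟨w, by omega, L, hL, hr'.sent hm'⟩

/-- A proposed block extends the genesis block, a block certified in the previous epoch, or the
highest block of two leader-down messages of the previous epoch. -/
theorem parent_of_prop (h : ClosedUnderReads P 𝓛) (hs : SentIn P 𝓛 k (.prop B v)) :
    1 ≤ v ∧ leader v = k ∧ ∃ A xs, B = A ++ [⟨v, xs⟩] ∧
      ((v = 1 ∧ A = []) ∨ CertifiedIn P 𝓛 A (v - 1) ∨
        ∃ Ds : List (Fin 3 × OBlock Tx), (∀ d ∈ Ds, SentIn P 𝓛 d.1 (.down d.2 (v - 1))) ∧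
          2 ≤ (Ds.map Prod.fst).toFinset.card ∧ A = highest (Ds.map Prod.snd)) := by
  obtain ⟨L, hL, hm⟩ := hs
  obtain ⟨q, r, hr, hm⟩ := mem_run_sent.1 hm
  obtain ⟨rfl, hk, A, hA, rfl⟩ := prop_mem_actions.1 hm
  have hv : 1 ≤ v := by have := hr.pos; omega
  refine ⟨hv, hk, A, _, rfl, ?_⟩
  rcases parent?_eq_some hA with ⟨h1, h2⟩ | hc | ⟨hc, hA⟩
  · exact .inl ⟨by omega, h2⟩
  · exact .inr (.inl (h.certifiedIn_of_actsAt hL hr hc))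
  · exact .inr (.inr ⟨_, fun d hd => h.sent_of_actsAt hL hr (mem_downs.1 hd), hc, hA⟩)

/-- A proposed block is the genesis block plus a chain whose epochs increase strictly. -/
theorem wellFormed_of_prop (h : ClosedUnderReads P 𝓛) :
    ∀ {v : ℕ} {k : Fin 3} {B : OBlock Tx}, SentIn P 𝓛 k (.prop B v) →
      OBlock.epochNo B = v ∧ B.Pairwise (fun b b' => b.epoch < b'.epoch) ∧
        ∀ b ∈ B, b.epoch ≤ v := by
  intro v
  induction v using Nat.strong_induction_on with
  | _ v ih =>
    intro k B hs
    obtain ⟨hv, -, A, xs, rfl, hA⟩ := h.parent_of_prop hs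
    -- A parent other than genesis was acknowledged, hence proposed, in an earlier epoch.
    -- Consistency of the ledgers plays no role here.
    have hacked : A = [] ∨ ∃ w < v, ∃ a, SentIn P 𝓛 a (.ack A w) := by
      rcases hA with ⟨-, rfl⟩ | ⟨Q, hQ, hc⟩ | ⟨Ds, hDs, -, rfl⟩
      · exact .inl rfl
      · obtain ⟨a, ha⟩ := Finset.card_pos.1 (by omega : 0 < Q.card)
        exact .inr ⟨v - 1, by omega, a, hc a ha⟩
      · rcases highest_eq_nil_or_mem (Ds.map Prod.snd) with hA | hA
        · exact .inl hA
        · obtain ⟨d, hd, hdA⟩ := List.mem_map.1 hA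
          rw [← hdA]
          refine (ack_of_down (hDs d hd)).imp_right ?_
          rintro ⟨w, hw, hs⟩
          exact ⟨w, by omega, _, hs⟩
    have hA' : A.Pairwise (fun b b' => b.epoch < b'.epoch) ∧ ∀ b ∈ A, b.epoch < v := by
      rcases hacked with rfl | ⟨w, hw, a, hs⟩
      · simp
      · obtain ⟨-, h1, h2⟩ := ih w hw (h.prop_of_ack hs)
        exact ⟨h1, fun b hb => (h2 b hb).trans_lt hw⟩
    refine ⟨OBlock.epochNo_concat _ _, ?_, ?_⟩
    · rw [List.pairwise_append]
      refine ⟨hA'.1, by simp, fun b hb b' hb' => ?_⟩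
      rw [List.mem_singleton.1 hb']
      exact hA'.2 b hb
    · intro b hb
      rcases List.mem_append.1 hb with hb | hb
      · exact (hA'.2 b hb).le
      · rw [List.mem_singleton.1 hb]

end ClosedUnderReads

/-! ### Safety of the overlay blocks -/

theorem Consistent.of_prefix {A : Type} {L₁ L₂ M₁ M₂ : List A} (h : Consistent M₁ M₂)
    (h₁ : L₁ <+: M₁) (h₂ : L₂ <+: M₂) : Consistent L₁ L₂ := by
  rcases h with h | h
  · exact List.prefix_or_prefix_of_prefix (h₁.trans h) h₂
  · exact List.prefix_or_prefix_of_prefix h₁ (h₂.trans h)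

/-- The ledgers of the family are pairwise consistent on each chain. -/
def FamilyConsistent (𝓛 : Fin 3 → Set (List (Block (UTx Tx Msg)))) : Prop :=
  ∀ k, ∀ L ∈ 𝓛 k, ∀ L' ∈ 𝓛 k, Consistent L L'

namespace FamilyConsistent

variable {k : Fin 3} {v w : ℕ} {B B' : OBlock Tx}

/-- Consistency enters the argument only here: the longer of two ledgers of a chain shows both
messages, so they can be compared within one history. -/
theorem common (hc : FamilyConsistent 𝓛) {m m' : OMsg Tx} (h : SentIn P 𝓛 k m)
    (h' : SentIn P 𝓛 k m') :
    ∃ L ∈ 𝓛 k, m ∈ (run k (P.T k) P.Tc L).sent ∧ m' ∈ (run k (P.T k) P.Tc L).sent := by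
  obtain ⟨L, hL, hm⟩ := h
  obtain ⟨L', hL', hm'⟩ := h'
  rcases hc k L hL L' hL' with hp | hp
  · exact ⟨L', hL', run_sent_mono hp hm, hm'⟩
  · exact ⟨L, hL, hm, run_sent_mono hp hm'⟩

theorem prop_unique (hc : FamilyConsistent 𝓛) (h : SentIn P 𝓛 k (.prop B v))
    (h' : SentIn P 𝓛 k (.prop B' v)) : B = B' := by
  obtain ⟨L, hL, hm, hm'⟩ := hc.common h h'
  obtain ⟨q, r, hr, hm⟩ := mem_run_sent.1 hm
  obtain ⟨q', r', hr', hm'⟩ := mem_run_sent.1 hm'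
  obtain ⟨rfl, -, A, hA, rfl⟩ := prop_mem_actions.1 hm
  obtain ⟨rfl, -, A', hA', rfl⟩ := prop_mem_actions.1 hm'
  obtain rfl := hr.unique hr'
  rw [hA] at hA'
  rw [Option.some.inj hA']

/-- The acknowledgement, of phase `3 * v + 1`, precedes phase `3 * w + 2`, so `B` is among the
blocks over which the leader-down message takes the maximum. -/
theorem epochNo_le_of_down (hc : FamilyConsistent 𝓛) (h : SentIn P 𝓛 k (.ack B v))
    (h' : SentIn P 𝓛 k (.down B' w)) (hvw : v ≤ w) : OBlock.epochNo B ≤ OBlock.epochNo B' := by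
  obtain ⟨L, hL, hm, hm'⟩ := hc.common h h'
  obtain ⟨q, r, hr, hm⟩ := mem_run_sent.1 hm
  obtain ⟨q', r', hr', hm'⟩ := mem_run_sent.1 hm'
  have hq := (ack_mem_actions.1 hm).1
  obtain ⟨hq', -, rfl⟩ := down_mem_actions.1 hm'
  exact epochNo_le_highest (mem_acked.2 ⟨v, hr'.mem_sent_iff.2 ⟨q, by omega, r, hr, hm⟩⟩)

/-- Every proposal extends every block that has been certified in an earlier epoch. -/
theorem prefix_of_prop (hc : FamilyConsistent 𝓛) (hr : ClosedUnderReads P 𝓛)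
    (hB : CertifiedIn P 𝓛 B v) (hs : SentIn P 𝓛 k (.prop B' w)) (hvw : v ≤ w) : B <+: B' := by
  obtain ⟨Q, hQ, hQs⟩ := hB
  obtain ⟨a, ha⟩ := Finset.card_pos.1 (by omega : 0 < Q.card)
  have hprop := hr.prop_of_ack (hQs a ha)
  have hBv := (hr.wellFormed_of_prop hprop).1
  have hv := (hr.parent_of_prop hprop).1
  induction w using Nat.strong_induction_on generalizing k B' with
  | _ w ih =>
    obtain ⟨-, hk, A, xs, hB', hA⟩ := hr.parent_of_prop hs
    rcases hvw.eq_or_lt with rfl | hlt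
    · subst hk
      rw [hc.prop_unique hprop hs]
    · rw [hB']
      refine List.IsPrefix.trans ?_ (List.prefix_append _ _)
      rcases hA with ⟨h1, -⟩ | ⟨R, hR, hRs⟩ | ⟨Ds, hDs, hcard, rfl⟩
      · omega
      -- A certified parent was proposed in epoch `w - 1 ≥ v`, where the induction hypothesis
      -- applies.
      · obtain ⟨c, hcR⟩ := Finset.card_pos.1 (by omega : 0 < R.card)
        exact ih (w - 1) (by omega) (hr.prop_of_ack (hRs c hcR)) (by omega)
      -- Two senders of leader-down messages and two acknowledgers of `B` among three validators:
      -- some validator is both.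
      · obtain ⟨c, hcc⟩ := Finset.inter_nonempty_of_card_lt_card_add_card (Finset.subset_univ Q)
          (Finset.subset_univ (Ds.map Prod.fst).toFinset) (by
            rw [Finset.card_univ, Fintype.card_fin]; omega)
        rw [Finset.mem_inter, List.mem_toFinset, List.mem_map] at hcc
        obtain ⟨hcQ, d, hd, rfl⟩ := hcc
        have hle := (hc.epochNo_le_of_down (hQs _ hcQ) (hDs d hd) (by omega)).trans
          (epochNo_le_highest (List.mem_map_of_mem hd))
        rcases highest_eq_nil_or_mem (Ds.map Prod.snd) with hnil | hmem
        · rw [hnil, hBv] at hle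
          simp only [OBlock.epochNo, List.getLast?_nil, Option.map_none, Option.getD_none] at hle
          omega
        · obtain ⟨d', hd', hdA⟩ := List.mem_map.1 hmem
          rw [← hdA, hBv] at hle
          rw [← hdA]
          -- The highest block has epoch at least `v ≥ 1`, so it is not genesis, whose epoch is `0`
          -- by default. It was proposed in its own epoch `u`, with `v ≤ u < w`.
          rcases ClosedUnderReads.ack_of_down (hDs d' hd') with hnil | ⟨u, hu, hack⟩
          · rw [hnil] at hle
            simp only [OBlock.epochNo, List.getLast?_nil, Option.map_none, Option.getD_none] at hle
            omega
          · have hprop' := hr.prop_of_ack hack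
            rw [(hr.wellFormed_of_prop hprop').1] at hle
            exact ih u (by omega) hprop' hle

theorem consistent_of_committed (hc : FamilyConsistent 𝓛) (hr : ClosedUnderReads P 𝓛)
    {k' : Fin 3} {L L' : List (Block (UTx Tx Msg))} (hL : L ∈ 𝓛 k) (hL' : L' ∈ 𝓛 k')
    (hB : B ∈ committed k (P.T k) P.Tc L) (hB' : B' ∈ committed k' (P.T k') P.Tc L') :
    Consistent B B' := by
  obtain ⟨v, hp, hcert⟩ := hr.certifiedIn_of_committed hL hB
  obtain ⟨w, hp', hcert'⟩ := hr.certifiedIn_of_committed hL' hB'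
  rcases le_total v w with h | h
  · exact .inl (hc.prefix_of_prop hr hcert hp' h)
  · exact .inr (hc.prefix_of_prop hr hcert' hp h)

end FamilyConsistent

end Family

/-! ### The ledger of the client -/

section Client

variable {Tx : Type} [DecidableEq Tx] {F Bs : List (OBlock Tx)} {B C : OBlock Tx}

theorem mem_acceptedBlocks {c : Fin 3 → List (OBlock Tx)} :
    B ∈ acceptedBlocks c ↔ ∃ k k', k ≠ k' ∧ B ∈ c k ∧ B ∈ c k' := by
  simp only [acceptedBlocks, List.mem_filter, decide_eq_true_eq, List.mem_append]
  constructor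
  · rintro ⟨-, h⟩
    obtain ⟨k, hk, k', hk', hne⟩ := Finset.one_lt_card.1 h
    exact ⟨k, k', hne, (Finset.mem_filter.1 hk).2, (Finset.mem_filter.1 hk').2⟩
  · rintro ⟨k, k', hne, hk, hk'⟩
    refine ⟨?_, Finset.one_lt_card.2 ⟨k, by simpa using hk, k', by simpa using hk', hne⟩⟩
    fin_cases k <;> simp_all

/-- Append the blocks of the chain of `B` that are not in `F` yet. -/
def extendByBlock (F : List (OBlock Tx)) (B : OBlock Tx) : List (OBlock Tx) :=
  F ++ B.inits.tail.filter fun A => decide (A ∉ F)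

theorem extendBy_eq : extendBy F Bs =
    (Bs.mergeSort fun B B' => decide (OBlock.epochNo B ≤ OBlock.epochNo B')).foldl
      extendByBlock F := rfl

theorem prefix_foldl_extendByBlock : F <+: Bs.foldl extendByBlock F := by
  induction Bs generalizing F with
  | nil => exact List.prefix_rfl
  | cons B Bs ih => exact (List.prefix_append _ _).trans (ih (F := extendByBlock F B))

theorem prefix_extendBy : F <+: extendBy F Bs := prefix_foldl_extendByBlock

/-- As a block is identified with its chain, `B.inits.tail` is the list of the blocks on the chain
of `B`, oldest first and without genesis. -/
theorem mem_inits_tail {A : OBlock Tx} : A ∈ B.inits.tail ↔ A ≠ [] ∧ A <+: B := by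
  have h : B.inits = [] :: B.inits.tail := by cases B <;> simp
  have hnd : [] ∉ B.inits.tail := by cases B <;> simp
  rw [← List.mem_inits, h, List.mem_cons]
  constructor
  · intro hA
    exact ⟨fun h0 => hnd (h0 ▸ hA), .inr hA⟩
  · rintro ⟨h1, h2 | h2⟩
    · exact absurd h2 h1
    · exact h2

theorem mem_foldl_extendByBlock {A : OBlock Tx} :
    A ∈ Bs.foldl extendByBlock F ↔ A ∈ F ∨ ∃ B ∈ Bs, A ≠ [] ∧ A <+: B := by
  induction Bs generalizing F with
  | nil => simp
  | cons B Bs ih =>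
    rw [List.foldl_cons, ih, extendByBlock, List.mem_append, List.mem_filter, mem_inits_tail]
    simp only [decide_eq_true_eq, List.mem_cons, exists_eq_or_imp]
    tauto

theorem mem_extendBy {A : OBlock Tx} :
    A ∈ extendBy F Bs ↔ A ∈ F ∨ ∃ B ∈ Bs, A ≠ [] ∧ A <+: B := by
  rw [extendBy_eq, mem_foldl_extendByBlock]
  simp [List.mem_mergeSort]

theorem inits_tail_append (C D : OBlock Tx) :
    (C ++ D).inits.tail = C.inits.tail ++ D.inits.tail.map (C ++ ·) := by
  rw [List.inits_append]
  cases C <;> simp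

theorem inits_tail_prefix (h : B <+: C) : B.inits.tail <+: C.inits.tail := by
  obtain ⟨D, rfl⟩ := h
  rw [inits_tail_append]
  exact List.prefix_append _ _

/-- Extending a finalized chain by a consistent one yields the longer one of the two. -/
theorem extendByBlock_inits (h : Consistent B C) :
    extendByBlock B.inits.tail C = (if B <+: C then C else B).inits.tail := by
  rw [extendByBlock]
  split_ifs with hBC
  · obtain ⟨D, rfl⟩ := hBC
    rw [inits_tail_append, List.filter_append, List.filter_eq_nil_iff.2 (by simp),
      List.nil_append, List.filter_eq_self.2]
    intro A hA
    obtain ⟨E, hE, rfl⟩ := List.mem_map.1 hA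
    simp only [decide_eq_true_eq, mem_inits_tail, not_and]
    intro _ hpre
    have := hpre.length_le
    have hE0 : E ≠ [] := (mem_inits_tail.1 hE).1
    have : E.length = 0 := by rw [List.length_append] at this; omega
    exact hE0 (List.length_eq_zero_iff.1 this)
  · have hCB := h.resolve_left hBC
    rw [List.filter_eq_nil_iff.2, List.append_nil]
    intro A hA
    simp only [decide_eq_true_eq, not_not]
    exact (inits_tail_prefix hCB).subset hA

/-- Extending a finalized chain by blocks from a set of consistent chains. -/
theorem extendBy_inits {S : Set (OBlock Tx)} (hS : ∀ B ∈ S, ∀ C ∈ S, Consistent B C)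
    (hB : B ∈ S) (hBs : ∀ C ∈ Bs, C ∈ S) : ∃ C ∈ S, extendBy B.inits.tail Bs = C.inits.tail := by
  have key : ∀ (Bs : List (OBlock Tx)), (∀ C ∈ Bs, C ∈ S) → ∀ B ∈ S,
      ∃ C ∈ S, Bs.foldl extendByBlock B.inits.tail = C.inits.tail := by
    intro Bs
    induction Bs with
    | nil => exact fun _ B hB => ⟨B, hB, rfl⟩
    | cons D Bs ih =>
      intro hBs B hB
      rw [List.foldl_cons, extendByBlock_inits (hS B hB D (hBs D (by simp)))]
      refine ih (fun C hC => hBs C (by simp [hC])) _ ?_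
      split_ifs
      · exact hBs D (by simp)
      · exact hB
  rw [extendBy_eq]
  exact key _ (fun C hC => hBs C (List.mem_mergeSort.1 hC)) B hB

theorem sanitize_concat (F : List (OBlock Tx)) (B : OBlock Tx) :
    sanitize (F ++ [B]) = sanitize F ++
      [⟨OBlock.epochNo B, fresh (txsOf (sanitize F)) ((B.getLast?.map Block.txs).getD [])⟩] := by
  simp [sanitize]

theorem sanitize_prefix {F F' : List (OBlock Tx)} (h : F <+: F') : sanitize F <+: sanitize F' := by
  obtain ⟨D, rfl⟩ := h
  induction D using List.reverseRecOn with
  | nil => simp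
  | append_singleton D B ih =>
    rw [← List.append_assoc, sanitize_concat]
    exact ih.trans (List.prefix_append _ _)

/-- Removing repeated transactions may empty a block but never drops it, so epochs can be read off
before sanitizing. -/
theorem sanitize_map_epoch (F : List (OBlock Tx)) :
    (sanitize F).map Block.epoch = F.map OBlock.epochNo := by
  induction F using List.reverseRecOn with
  | nil => simp [sanitize]
  | append_singleton F B ih => simp [sanitize_concat, ih]

theorem inits_tail_map_epochNo (B : OBlock Tx) :
    B.inits.tail.map OBlock.epochNo = B.map Block.epoch := by
  induction B using List.reverseRecOn with
  | nil => simp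
  | append_singleton B b ih =>
    rw [inits_tail_append, List.map_append, ih]
    simp [OBlock.epochNo]

theorem mem_foldl_fresh {old : List Tx} {xs acc : List Tx} {x : Tx} :
    x ∈ xs.foldl (fun a x => if x ∈ old ∨ x ∈ a then a else a ++ [x]) acc ↔
      x ∈ acc ∨ (x ∈ xs ∧ x ∉ old) := by
  induction xs generalizing acc with
  | nil => simp
  | cons y ys ih =>
    rw [List.foldl_cons, ih]
    by_cases hy : y ∈ old ∨ y ∈ acc
    · rw [if_pos hy]
      simp only [List.mem_cons]
      constructor
      · rintro (h | h)
        · exact .inl h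
        · exact .inr ⟨.inr h.1, h.2⟩
      · rintro (h | ⟨rfl | h, h'⟩)
        · exact .inl h
        · exact .inl (hy.resolve_left h')
        · exact .inr ⟨h, h'⟩
    · rw [if_neg hy]
      push Not at hy
      simp only [List.mem_append, List.mem_cons, List.not_mem_nil, or_false]
      constructor
      · rintro ((h | rfl) | h)
        · exact .inl h
        · exact .inr ⟨.inl rfl, hy.1⟩
        · exact .inr ⟨.inr h.1, h.2⟩
      · rintro (h | ⟨rfl | h, h'⟩)
        · exact .inl (.inl h)
        · exact .inl (.inr rfl)
        · exact .inr ⟨h, h'⟩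

theorem mem_fresh {old xs : List Tx} {x : Tx} : x ∈ fresh old xs ↔ x ∈ xs ∧ x ∉ old := by
  rw [fresh, mem_foldl_fresh]
  simp

theorem mem_txsOf {X : Type} {L : List (Block X)} {x : X} : x ∈ txsOf L ↔ ∃ b ∈ L, x ∈ b.txs :=
  List.mem_flatMap

theorem mem_txsOf_sanitize {b : Block Tx} {x : Tx} (hx : x ∈ b.txs) {A : OBlock Tx}
    (hA : A ++ [b] ∈ F) : x ∈ txsOf (sanitize F) := by
  induction F using List.reverseRecOn with
  | nil => simp at hA
  | append_singleton F B ih =>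
    have hsplit : ∀ c : Block Tx, txsOf (sanitize F ++ [c]) = txsOf (sanitize F) ++ c.txs := by
      simp [txsOf]
    rw [sanitize_concat, hsplit, List.mem_append]
    rcases List.mem_append.1 hA with h | h
    · exact .inl (ih h)
    · rw [← List.mem_singleton.1 h]
      by_cases hold : x ∈ txsOf (sanitize F)
      · exact .inl hold
      · exact .inr (mem_fresh.2 ⟨by simpa using hx, hold⟩)

end Client

/-! ### Ledgers of an execution -/

theorem prefix_takeWhile_of_forall {A : Type} {p : A → Bool} {L M : List A} (h : L <+: M)
    (hL : ∀ a ∈ L, p a = true) : L <+: M.takeWhile p := by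
  obtain ⟨D, rfl⟩ := h
  rw [List.takeWhile_append_of_pos hL]
  exact List.prefix_append _ _

namespace Setup

variable {Tx : Type} [DecidableEq Tx] {Msg : Fin 3 → Type} {P : Setup Tx Msg}

theorem blockValid_of_mem {k : Fin 3} {M : Finset (Msg k)} {b : Block (UTx Tx Msg)}
    (hb : b ∈ P.ledgerOf k M) : P.BlockValid b := by
  simpa using List.mem_takeWhile_imp hb

/-- The prefix that the certificate vouches for has only valid blocks, so it survives truncation at
the first invalid block, and sent messages persist under extension. -/
theorem Verified.mem_sent {k : Fin 3} {m : OMsg Tx} {M : Finset (Msg k)} (h : P.Verified k m M) :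
    m ∈ (run k (P.T k) P.Tc (P.ledgerOf k M)).sent := by
  cases h with
  | intro k m M L hp ht hc hm =>
    refine run_sent_mono (prefix_takeWhile_of_forall hp fun b hb => ?_) hm
    have hv : P.BlockValid b := ⟨ht b hb, hc b hb⟩
    simpa using hv

end Setup

namespace Execution

variable {Tx : Type} [DecidableEq Tx] {Msg : Fin 3 → Type} {P : Setup Tx Msg} {X : Execution P}

/-- The ledgers finalized by the clients by time `t`. -/
def ledgersUntil (X : Execution P) (t : ℕ) (k : Fin 3) : Set (List (Block (UTx Tx Msg))) :=
  {L | ∃ z s, s ≤ t ∧ X.active z s ∧ X.ledger k z s = L}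

/-- The ledgers confirmed by messages that have been broadcast by time `t`. -/
def ledgersConfirmed (X : Execution P) (t : ℕ) (k : Fin 3) : Set (List (Block (UTx Tx Msg))) :=
  {L | ∃ M : Finset (Msg k), (M : Set (Msg k)) ⊆ X.broadcast k t ∧ P.ledgerOf k M = L}

/-- Source of closure under reads: a recorded certificate is valid, and its ledger is a prefix of
one that a client of the source chain has finalized by then. -/
theorem exists_reader {k : Fin 3} {t : ℕ} {M : Finset (Msg k)}
    (hM : (M : Set (Msg k)) ⊆ X.broadcast k t) {a : Fin 3} {m : OMsg Tx}
    (h : Recorded (P.ledgerOf k M) a m) :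
    ∃ z s, s ≤ t ∧ X.active z s ∧ m ∈ (run a (P.T a) P.Tc (X.ledger a z s)).sent := by
  obtain ⟨b, hb, M', hM'⟩ := h
  obtain ⟨z, s, hs, hz, hp⟩ := X.certificate_read k t M hM b hb a m M' hM'
  exact ⟨z, s, hs, hz, run_sent_mono hp ((Setup.blockValid_of_mem hb).2 a m M' hM').mem_sent⟩

theorem closed_ledgersUntil (t : ℕ) : ClosedUnderReads P (X.ledgersUntil t) := by
  rintro k _ ⟨z, s, hs, hz, rfl⟩ a m hm
  obtain ⟨z', s', hs', hz', h⟩ := exists_reader (X.view_subset z k s) hm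
  exact ⟨_, ⟨z', s', hs'.trans hs, hz', rfl⟩, h⟩

theorem closed_ledgersConfirmed (t : ℕ) : ClosedUnderReads P (X.ledgersConfirmed t) := by
  rintro k _ ⟨M, hM, rfl⟩ a m hm
  obtain ⟨z', s', hs', hz', h⟩ := exists_reader hM hm
  exact ⟨_, ⟨_, (X.view_subset z' a s').trans (X.broadcast_mono a s' t hs'), rfl⟩, h⟩

theorem mem_commits {z : X.Client} {t : ℕ} {k : Fin 3} {B : OBlock Tx} :
    B ∈ X.commits z t k ↔
      ∃ s ≤ t, X.online z s ∧ B ∈ committed k (P.T k) P.Tc (X.ledger k z s) := by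
  simp only [commits, List.mem_flatMap, List.mem_range, Nat.lt_succ_iff]
  refine exists_congr fun s => and_congr_right fun _ => ?_
  split_ifs with h <;> simp [h]

theorem accepted_mono {z : X.Client} {t t' : ℕ} (h : t ≤ t') {B : OBlock Tx}
    (hB : B ∈ X.accepted z t) : B ∈ X.accepted z t' := by
  obtain ⟨k, k', hne, hk, hk'⟩ := mem_acceptedBlocks.1 hB
  have : ∀ k, B ∈ X.commits z t k → B ∈ X.commits z t' k := by
    intro k hk
    obtain ⟨s, hs, hz⟩ := mem_commits.1 hk
    exact mem_commits.2 ⟨s, hs.trans h, hz⟩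
  exact mem_acceptedBlocks.2 ⟨k, k', hne, this k hk, this k' hk'⟩

theorem exists_committed_of_accepted {z : X.Client} {t : ℕ} {B : OBlock Tx}
    (hB : B ∈ X.accepted z t) :
    ∃ s ≤ t, X.online z s ∧ ∃ k, B ∈ committed k (P.T k) P.Tc (X.ledger k z s) := by
  obtain ⟨k, -, -, hk, -⟩ := mem_acceptedBlocks.1 hB
  obtain ⟨s, hs, hz, h⟩ := mem_commits.1 hk
  exact ⟨s, hs, hz, k, h⟩

/-! ### Epochs of the overlay protocol -/

/-- Committed blocks are chains of strictly increasing epochs that have begun. -/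
theorem wellFormed_of_committed (hX : X.UnderlaysInEpochs) {z : X.Client} {t : ℕ}
    (hz : X.online z t) {k : Fin 3} {B : OBlock Tx}
    (hB : B ∈ committed k (P.T k) P.Tc (X.ledger k z t)) :
    B.Pairwise (fun b b' => b.epoch < b'.epoch) ∧ (∀ b ∈ B, b.epoch ≤ OBlock.epochNo B) ∧
      OBlock.epochNo B * (3 * P.Tc) ≤ t := by
  have hcl := X.closed_ledgersUntil t
  obtain ⟨v, hp, -⟩ := hcl.certifiedIn_of_committed ⟨z, t, le_rfl, .inl hz, rfl⟩ hB
  obtain ⟨hv, h1, h2⟩ := hcl.wellFormed_of_prop hp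
  refine ⟨h1, hv ▸ h2, ?_⟩
  obtain ⟨_, ⟨z', s, hs, hz', rfl⟩, hm⟩ := hp
  obtain ⟨q, r, hr, hm⟩ := mem_run_sent.1 hm
  obtain ⟨hq, -⟩ := prop_mem_actions.1 hm
  obtain ⟨b, hb, hbq⟩ := hr.exists_block
  have hdate := ((hX (leader v)).2 z' s hz' _ rfl).2 b hb
  rw [hv]
  -- The block that triggered the proposal is dated in phase `3 * v`, and it was finalized no
  -- earlier than its date.
  calc v * (3 * P.Tc) = q * P.Tc := by rw [hq]; ring
    _ ≤ b.epoch * P.T (leader v) := by rw [← hbq]; exact Nat.div_mul_le_self _ _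
    _ ≤ t := hdate.trans hs

theorem wellFormed_of_accepted (hX : X.UnderlaysInEpochs) {z : X.Client} {t : ℕ} {B : OBlock Tx}
    (hB : B ∈ X.accepted z t) :
    B.Pairwise (fun b b' => b.epoch < b'.epoch) ∧ (∀ b ∈ B, b.epoch ≤ OBlock.epochNo B) ∧
      OBlock.epochNo B * (3 * P.Tc) ≤ t := by
  obtain ⟨s, hs, hz, k, hk⟩ := exists_committed_of_accepted hB
  obtain ⟨h1, h2, h3⟩ := wellFormed_of_committed hX hz hk
  exact ⟨h1, h2, h3.trans hs⟩

theorem accepted_proceedsInEpochs (hX : X.UnderlaysInEpochs) :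
    ProceedsInEpochs X.online (3 * P.Tc) (fun z t => {B | B ∈ X.accepted z t}) := by
  refine ⟨by have := P.Tc_pos; omega, fun z t _ B hB => ?_⟩
  obtain ⟨h1, h2, h3⟩ := wellFormed_of_accepted hX hB
  exact ⟨h1, fun b hb => (Nat.mul_le_mul_right _ (h2 b hb)).trans h3⟩

/-! ### Safety of the composition -/

theorem consistent_of_accepted (hsafe : ∀ k, X.UnderlaySafe k) {z z' : X.Client} {t t' : ℕ}
    {B B' : OBlock Tx} (hB : B ∈ X.accepted z t) (hB' : B' ∈ X.accepted z' t') :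
    Consistent B B' := by
  obtain ⟨s, hs, hz, k, hk⟩ := exists_committed_of_accepted hB
  obtain ⟨s', hs', hz', k', hk'⟩ := exists_committed_of_accepted hB'
  have hc : FamilyConsistent (X.ledgersUntil (max s s')) := by
    rintro k _ ⟨z, s, -, hz, rfl⟩ _ ⟨z', s', -, hz', rfl⟩
    exact (hsafe k).1 z z' s s' hz hz'
  exact hc.consistent_of_committed (X.closed_ledgersUntil _)
    ⟨z, s, le_max_left _ _, .inl hz, rfl⟩ ⟨z', s', le_max_right _ _, .inl hz', rfl⟩ hk hk'

/-- All accepted blocks lie on one chain, so the append-only list of the client is just the list of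
blocks of the longest chain accepted so far; `[]` covers the case that none has been. -/
theorem finalized_eq_inits (hsafe : ∀ k, X.UnderlaySafe k) (z : X.Client) (t : ℕ) :
    ∃ C, (C = [] ∨ C ∈ X.accepted z t) ∧ X.finalized z t = C.inits.tail := by
  have hS : ∀ t, ∀ B ∈ {C | C = [] ∨ C ∈ X.accepted z t},
      ∀ C ∈ {C | C = [] ∨ C ∈ X.accepted z t}, Consistent B C := by
    rintro t B (rfl | hB) C hC
    · exact .inl List.nil_prefix
    · rcases hC with rfl | hC
      · exact .inr List.nil_prefix
      · exact consistent_of_accepted hsafe hB hC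
  induction t with
  | zero => exact extendBy_inits (hS 0) (B := []) (.inl rfl) fun C hC => .inr hC
  | succ t ih =>
    obtain ⟨C, hC, hF⟩ := ih
    rw [finalized, hF]
    exact extendBy_inits (hS (t + 1)) (hC.imp_right (accepted_mono (Nat.le_succ t)))
      fun C hC => .inr hC

theorem finalized_mono (z : X.Client) {t t' : ℕ} (h : t ≤ t') :
    X.finalized z t <+: X.finalized z t' := by
  induction t', h using Nat.le_induction with
  | base => exact List.prefix_rfl
  | succ t' _ ih => exact ih.trans prefix_extendBy

theorem overlaySafe (hsafe : ∀ k, X.UnderlaySafe k) : X.OverlaySafe := by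
  refine ⟨fun z z' t t' _ _ => ?_, fun z t t' _ _ h => sanitize_prefix (finalized_mono z h)⟩
  obtain ⟨C, hC, hF⟩ := finalized_eq_inits hsafe z t
  obtain ⟨C', hC', hF'⟩ := finalized_eq_inits hsafe z' t'
  rw [overlayLedger, overlayLedger, hF, hF']
  have hcons : Consistent C C' := by
    rcases hC with rfl | hC
    · exact .inl List.nil_prefix
    · rcases hC' with rfl | hC'
      · exact .inr List.nil_prefix
      · exact consistent_of_accepted hsafe hC hC'
  exact hcons.imp (fun h => sanitize_prefix (inits_tail_prefix h))
    fun h => sanitize_prefix (inits_tail_prefix h)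

theorem overlayLedger_proceedsInEpochs (hX : X.UnderlaysInEpochs)
    (hsafe : ∀ k, X.UnderlaySafe k) :
    ProceedsInEpochs X.online (3 * P.Tc) fun z t => {X.overlayLedger z t} := by
  refine ⟨by have := P.Tc_pos; omega, ?_⟩
  rintro z t hz _ rfl
  obtain ⟨C, hC, hF⟩ := finalized_eq_inits hsafe z t
  have hmap : (X.overlayLedger z t).map Block.epoch = C.map Block.epoch := by
    rw [overlayLedger, sanitize_map_epoch, hF, inits_tail_map_epochNo]
  have hwf : C.Pairwise (fun b b' => b.epoch < b'.epoch) ∧ ∀ b ∈ C, b.epoch * (3 * P.Tc) ≤ t := by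
    rcases hC with rfl | hC
    · simp
    · exact (accepted_proceedsInEpochs hX).2 z t hz C hC
  constructor
  · rw [← List.pairwise_map (f := Block.epoch) (R := (· < ·)), hmap, List.pairwise_map]
    exact hwf.1
  · intro b hb
    have hb' := List.mem_map_of_mem (f := Block.epoch) hb
    rw [hmap] at hb'
    obtain ⟨c, hc, hcb⟩ := List.mem_map.1 hb'
    rw [← hcb]
    exact hwf.2 c hc

/-! ### Certificates -/

/-- Holds execution by execution: without underlay conflicts, the ledgers confirmed by broadcast
messages are a consistent family closed under reads, and the safety argument applies to it. -/
theorem exists_underlayConflict (h : X.OverlayConflict) : ∃ k, X.UnderlayConflict k := by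
  by_contra hno
  push Not at hno
  obtain ⟨t, M₁, M₂, L₁, L₂, h₁, h₂, hp₁, hp₂, hL⟩ := h
  refine hL (Consistent.of_prefix ?_ hp₁ hp₂)
  have hc : FamilyConsistent (X.ledgersConfirmed t) := by
    rintro k _ ⟨M, hM, rfl⟩ _ ⟨M', hM', rfl⟩
    by_contra hn
    exact hno k ⟨t, M, M', _, _, hM, hM', List.prefix_rfl, List.prefix_rfl, hn⟩
  set S : Set (OBlock Tx) :=
    {B | B = [] ∨ ∃ k, ∃ L ∈ X.ledgersConfirmed t k, B ∈ committed k (P.T k) P.Tc L} with hSdef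
  have hS : ∀ B ∈ S, ∀ C ∈ S, Consistent B C := by
    rintro B (rfl | ⟨k, L, hL, hB⟩) C hC
    · exact .inl List.nil_prefix
    · rcases hC with rfl | ⟨k', L', hL', hC⟩
      · exact .inr List.nil_prefix
      · exact hc.consistent_of_committed (X.closed_ledgersConfirmed t) hL hL' hB hC
  have key : ∀ M : (k : Fin 3) → Finset (Msg k),
      (∀ k, (M k : Set (Msg k)) ⊆ X.broadcast k t) →
        ∃ C ∈ S, P.overlayLedgerOf M = sanitize C.inits.tail := by
    intro M hM
    obtain ⟨C, hC, hF⟩ := extendBy_inits hS (B := []) (.inl rfl)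
      (Bs := acceptedBlocks fun k => committed k (P.T k) P.Tc (P.ledgerOf k (M k))) (by
        intro C hC
        obtain ⟨k, -, -, hk, -⟩ := mem_acceptedBlocks.1 hC
        exact .inr ⟨k, _, ⟨M k, hM k, rfl⟩, hk⟩)
    exact ⟨C, hC, congrArg sanitize hF⟩
  obtain ⟨C₁, hC₁, e₁⟩ := key M₁ h₁
  obtain ⟨C₂, hC₂, e₂⟩ := key M₂ h₂
  rw [e₁, e₂]
  exact (hS C₁ hC₁ C₂ hC₂).imp (fun h => sanitize_prefix (inits_tail_prefix h))
    fun h => sanitize_prefix (inits_tail_prefix h)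

theorem overlay_generatesCertificates {Ω : Type} [MeasurableSpace Ω]
    (μ : MeasureTheory.Measure Ω) (X : Ω → Execution P) (cond : Fin 3 → Ω → Prop)
    (ε : Fin 3 → ENNReal)
    (h : ∀ k, GeneratesCertificates μ (ε k) (cond k) fun ω => (X ω).UnderlayConflict k) :
    GeneratesCertificates μ (∑ k, ε k) (fun ω => ∀ k, cond k ω)
      fun ω => (X ω).OverlayConflict := by
  unfold GeneratesCertificates at h ⊢
  calc μ {ω | (∀ k, cond k ω) ∧ (X ω).OverlayConflict}
      ≤ μ (⋃ k, {ω | cond k ω ∧ (X ω).UnderlayConflict k}) := by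
        refine MeasureTheory.measure_mono fun ω hω => ?_
        obtain ⟨k, hk⟩ := exists_underlayConflict hω.2
        exact Set.mem_iUnion.2 ⟨k, hω.1 k, hk⟩
    _ ≤ ∑ k, μ {ω | cond k ω ∧ (X ω).UnderlayConflict k} := by
        simpa using MeasureTheory.measure_iUnion_fintype_le μ
          fun k => {ω | cond k ω ∧ (X ω).UnderlayConflict k}
    _ < ∑ k, ε k := by
        simp only [Fin.sum_univ_three]
        exact ENNReal.add_lt_add (ENNReal.add_lt_add (h 0) (h 1)) (h 2)

end Execution

/-! ### Liveness of the composition -/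

/-- Consecutive leaders differ, and only one of the three chains is neither `i` nor `j`. -/
theorem leader_consecutive {i j : Fin 3} (hij : i ≠ j) (v : ℕ) :
    ∃ w, v ≤ w ∧ w ≤ v + 1 ∧ (leader w = i ∨ leader w = j) := by
  have hval : ∀ w, (leader w).val = w % 3 := fun w => rfl
  by_contra hno
  push Not at hno
  obtain ⟨h1, h2⟩ := hno v le_rfl (Nat.le_succ v)
  obtain ⟨h3, h4⟩ := hno (v + 1) (Nat.le_succ v) le_rfl
  rw [Ne, Fin.ext_iff, hval] at h1 h2 h3 h4
  rw [Ne, Fin.ext_iff] at hij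
  omega

/-- Blocks are appended in the order of their epochs, so whatever is appended up to `B` comes from
chains of at most its epoch. This matters when accepted blocks conflict. -/
theorem exists_prefix_extendBy {Tx : Type} [DecidableEq Tx] {F Bs : List (OBlock Tx)}
    {B : OBlock Tx} (hB : B ∈ Bs) {p : OBlock Tx → Prop} (hF : ∀ A ∈ F, p A)
    (hBs : ∀ C ∈ Bs, OBlock.epochNo C ≤ OBlock.epochNo B → ∀ A, A ≠ [] → A <+: C → p A) :
    ∃ F', F' <+: extendBy F Bs ∧ (∀ A ∈ F', p A) ∧ ∀ A, A ≠ [] → A <+: B → A ∈ F' := by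
  have hsort := List.pairwise_mergeSort
    (le := fun B B' : OBlock Tx => decide (OBlock.epochNo B ≤ OBlock.epochNo B'))
    (by simpa using fun a b c => le_trans) (by simpa using fun a b => le_total _ _) Bs
  obtain ⟨l₁, l₂, hl⟩ := List.append_of_mem (List.mem_mergeSort.2 hB)
  rw [hl, List.pairwise_append] at hsort
  refine ⟨(l₁ ++ [B]).foldl extendByBlock F, ?_, fun A hA => ?_, fun A hA hAB => ?_⟩
  · rw [extendBy_eq, hl, List.append_cons l₁ B l₂, List.foldl_append (l' := l₂)]
    exact prefix_foldl_extendByBlock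
  · rcases mem_foldl_extendByBlock.1 hA with h | ⟨C, hC, hne, hp⟩
    · exact hF A h
    · refine hBs C ?_ ?_ A hne hp
      · rw [← List.mem_mergeSort, hl, List.append_cons]
        exact List.mem_append_left _ hC
      · rcases List.mem_append.1 hC with h | h
        · simpa using hsort.2.2 C h B (by simp)
        · rw [List.mem_singleton.1 h]
  · exact mem_foldl_extendByBlock.2 (.inr ⟨B, by simp, hA, hAB⟩)

namespace Execution

variable {Tx : Type} [DecidableEq Tx] {Msg : Fin 3 → Type} {P : Setup Tx Msg} {X : Execution P}
  {Tconf : ℕ}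

/-- From phase `q` on, an earlier block of every live chain has a transaction with property `p`. -/
def KnownBefore (X : Execution P) (Tconf q : ℕ) (p : UTx Tx Msg → Prop) : Prop :=
  ∀ l, X.UnderlayLive l Tconf → ∀ z t, X.online z t → q * P.Tc ≤ t →
    ∃ b ∈ X.ledger l z t, b.epoch * P.T l / P.Tc < q ∧ ∃ y ∈ b.txs, p y

/-- The transaction carries the overlay message `m` from chain `a`. -/
def Carries (a : Fin 3) (m : OMsg Tx) (y : UTx Tx Msg) : Prop :=
  ∃ M : Finset (Msg a), y = UTx.recv a m M

theorem KnownBefore.recorded {q : ℕ} {a : Fin 3} {m : OMsg Tx}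
    (h : X.KnownBefore Tconf q (Carries a m)) {l : Fin 3} (hl : X.UnderlayLive l Tconf)
    {z : X.Client} {t : ℕ} (hz : X.online z t) (ht : q * P.Tc ≤ t) :
    Recorded (X.ledger l z t) a m := by
  obtain ⟨b, hb, -, _, hy, M, rfl⟩ := h l hl z t hz ht
  exact ⟨b, hb, M, hy⟩

/-- The date clause of liveness puts the block itself before phase `q`, on every ledger, so a
contract acting in phase `q` has already executed it. -/
theorem knownBefore_of_input {q t : ℕ} {p : UTx Tx Msg → Prop} (ht : max X.GST t + Tconf < q * P.Tc)
    (h : ∀ l, ∃ y, ∃ t' ≤ max X.GST t, X.input l y t' ∧ P.TxValid l t' y ∧ p y) :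
    X.KnownBefore Tconf q p := by
  intro l hl z s hz hs
  obtain ⟨y, t', ht', hin, hval, hp⟩ := h l
  obtain ⟨b, hb, hy, hdate⟩ := hl y t' ⟨hin, hval⟩ z s hz (by omega)
  exact ⟨b, hb, (Nat.div_lt_iff_lt_mul P.Tc_pos).2 (by omega), y, hy, hp⟩

/-- What an honest validator observes in time is known in the next phase. -/
theorem knownBefore_of_observed {z₀ : X.Client} (hz₀ : X.validator z₀) {q s : ℕ} (hs : X.GST ≤ s)
    (hq : s + Tconf + P.Δ < q * P.Tc) {a : Fin 3} {m : OMsg Tx}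
    (h : m ∈ (run a (P.T a) P.Tc (X.ledger a z₀ s)).sent ∨
      ∃ j, Recorded (X.ledger j z₀ s) a m) :
    X.KnownBefore Tconf q (Carries a m) := by
  refine knownBefore_of_input (t := s + P.Δ) (by omega) fun l => ?_
  obtain ⟨M, t, ht, hM, hin⟩ := X.relay z₀ s hz₀ a m h l
  exact ⟨_, t, by omega, hin, hM, M, rfl⟩

/-- After `GST`, a live chain has a block in every phase, in time. -/
theorem exists_phase_block {k : Fin 3} (hk : X.UnderlayLive k Tconf)
    (hTc : P.T k + 2 * Tconf + P.Δ ≤ P.Tc) {q : ℕ} (hq : X.GST ≤ q * P.Tc) :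
    ∃ s, q * P.Tc ≤ s ∧ s + Tconf + P.Δ < (q + 1) * P.Tc ∧ ∀ z, X.online z s →
      ∃ b ∈ X.ledger k z s, b.epoch * P.T k / P.Tc = q := by
  have hT := P.T_pos k
  -- The first underlay epoch that starts in phase `q` or at its beginning: the quotient rounded up.
  obtain ⟨e, he₁, he₂⟩ : ∃ e, q * P.Tc ≤ e * P.T k ∧ e * P.T k < q * P.Tc + P.T k := by
    refine ⟨(q * P.Tc + P.T k - 1) / P.T k, ?_, ?_⟩
    · have := Nat.div_add_mod (q * P.Tc + P.T k - 1) (P.T k)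
      have := Nat.mod_lt (q * P.Tc + P.T k - 1) hT
      rw [mul_comm (_ / _)]
      omega
    · have := Nat.div_mul_le_self (q * P.Tc + P.T k - 1) (P.T k)
      omega
  have hexp : (q + 1) * P.Tc = q * P.Tc + P.Tc := by ring
  -- The timer is confirmed less than `P.T k + Tconf` after the phase begins. The other `Tconf +
  -- P.Δ` in the bound on `P.Tc` leaves time to relay and confirm the messages of the contract.
  -- Validity of the timer dates its block from below, liveness from above.
  refine ⟨e * P.T k + Tconf, by omega, by omega, fun z hz => ?_⟩
  obtain ⟨b, hb, hy, hdate⟩ := hk (UTx.timer e) (e * P.T k) ⟨X.timers k e, le_refl (e * P.T k)⟩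
    z _ hz (by omega)
  have hge : e * P.T k ≤ b.epoch * P.T k :=
    Nat.mul_le_mul_right _ ((Setup.blockValid_of_mem hb).1 e hy)
  refine ⟨b, hb, Nat.div_eq_of_lt_le (by omega) (by omega)⟩

/-- In every phase after `GST`, the contract on a live chain acts on a ledger that an honest
validator observes: it knows what has been recorded before the phase, and what it knows and sends
is recorded before the next phase. -/
theorem exists_action (hX : X.UnderlaysInEpochs) {k : Fin 3} (hk : X.UnderlayLive k Tconf)
    (hTc : P.T k + 2 * Tconf + P.Δ ≤ P.Tc) {q : ℕ} (hq₀ : 0 < q) (hq : X.GST ≤ q * P.Tc) :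
    ∃ r : CState Tx,
      (∀ a m, X.KnownBefore Tconf q (Carries a m) → (a, m) ∈ r.seen) ∧
      (∀ x, X.KnownBefore Tconf q (· = UTx.user x) → x ∈ r.pool) ∧
      (∀ a m, (a, m) ∈ r.seen → X.KnownBefore Tconf (q + 1) (Carries a m)) ∧
      ∀ m ∈ actions k q r, X.KnownBefore Tconf (q + 1) (Carries k m) := by
  -- One ledger seen by one honest validator suffices, since that validator relays what it sees. On
  -- a forked chain the contract may act differently elsewhere.
  obtain ⟨z₀, hz₀⟩ := X.exists_validator
  obtain ⟨s, hs₁, hs₂, hs₃⟩ := exists_phase_block hk hTc hq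
  have hon := X.validator_online z₀ s hz₀
  obtain ⟨b, hb, hbq⟩ := hs₃ z₀ hon
  obtain ⟨r, hr, hknow⟩ :=
    ActsAt.exists_of_mem ((hX k).2 z₀ s (.inl hon) _ rfl).1 hq₀ hb hbq
  refine ⟨r, fun a m h => ?_, fun x h => ?_, fun a m h => ?_, fun m h => ?_⟩
  · obtain ⟨b', hb', hlt, _, hy, M, rfl⟩ := h k hk z₀ s hon hs₁
    exact (hknow b' hb' hlt).1 a m M hy
  · obtain ⟨b', hb', hlt, _, hy, rfl⟩ := h k hk z₀ s hon hs₁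
    exact (hknow b' hb' hlt).2 x hy
  · refine knownBefore_of_observed (a := a) hz₀ (hq.trans hs₁) hs₂ ?_
    rcases hr.seen_or h with hm | ⟨rfl, hm⟩
    · exact .inr ⟨k, hm⟩
    · exact .inl hm
  · exact knownBefore_of_observed hz₀ (hq.trans hs₁) hs₂ (.inl (hr.sent h))

/-- At the end of an epoch, a certificate or two leader-down messages are known on the live
chains. -/
theorem exists_ticket (hX : X.UnderlaysInEpochs) (hTc : ∀ k, P.T k + 2 * Tconf + P.Δ ≤ P.Tc)
    {i j : Fin 3} (hi : X.UnderlayLive i Tconf) (hj : X.UnderlayLive j Tconf) {v : ℕ} (hv : 0 < v)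
    (hq : X.GST ≤ (3 * v + 2) * P.Tc) :
    (∃ (B : OBlock Tx) (Q : Finset (Fin 3)), 2 ≤ Q.card ∧
      ∀ a ∈ Q, X.KnownBefore Tconf (3 * v + 3) (Carries a (.ack B v))) ∨
    ∃ A A' : OBlock Tx, X.KnownBefore Tconf (3 * v + 3) (Carries i (.down A v)) ∧
      X.KnownBefore Tconf (3 * v + 3) (Carries j (.down A' v)) := by
  by_contra hno
  push Not at hno
  obtain ⟨hno₁, hno₂⟩ := hno
  have key : ∀ k, X.UnderlayLive k Tconf →
      ∃ A : OBlock Tx, X.KnownBefore Tconf (3 * v + 3) (Carries k (.down A v)) := by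
    intro k hk
    obtain ⟨r, -, -, h₁, h₂⟩ := exists_action hX hk (hTc k) (by omega) hq
    -- Had the contract observed a certificate, the acknowledgements in it would be relayed and
    -- known before phase `3 * v + 3`, against `hno₁`.
    refine ⟨_, h₂ _ (down_mem_actions.2 ⟨rfl, List.eq_nil_iff_forall_not_mem.2 fun B hB => ?_, rfl⟩)⟩
    obtain ⟨h0, -⟩ | hc := mem_certifiedBlocks.1 hB
    · omega
    · obtain ⟨Q, hQ, hs⟩ := isCertified_iff.1 hc
      obtain ⟨a, ha, hn⟩ := hno₁ B Q hQ
      exact hn (h₁ a _ (hs a ha))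
  obtain ⟨A, hA⟩ := key i hi
  obtain ⟨A', hA'⟩ := key j hj
  exact hno₂ A A' hA hA'

/-- The leader on a live chain proposes a block with all known transactions. -/
theorem exists_proposal (hX : X.UnderlaysInEpochs) (hTc : ∀ k, P.T k + 2 * Tconf + P.Δ ≤ P.Tc)
    {i j : Fin 3} (hij : i ≠ j) (hi : X.UnderlayLive i Tconf) (hj : X.UnderlayLive j Tconf) {v : ℕ}
    (hv : 0 < v) (hq : X.GST ≤ (3 * v + 2) * P.Tc) (hk : X.UnderlayLive (leader (v + 1)) Tconf) :
    ∃ B : OBlock Tx, OBlock.epochNo B = v + 1 ∧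
      X.KnownBefore Tconf (3 * (v + 1) + 1) (Carries (leader (v + 1)) (.prop B (v + 1))) ∧
      ∀ x, X.KnownBefore Tconf (3 * (v + 1)) (· = UTx.user x) → x ∈ txsOf B := by
  obtain ⟨r, hseen, hpool, -, hact⟩ := exists_action hX hk (hTc _) (q := 3 * (v + 1)) (by omega)
    (hq.trans (Nat.mul_le_mul_right _ (by omega)))
  obtain ⟨A, hA⟩ : ∃ A, parent? r.seen (v + 1 - 1) = some A := by
    rcases exists_ticket hX hTc hi hj hv hq with ⟨B, Q, hQ, h⟩ | ⟨A, A', hA, hA'⟩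
    · exact parent?_of_certified (isCertified_iff.2 ⟨Q, hQ, fun a ha => hseen a _ (h a ha)⟩)
    · exact parent?_of_downs hij (hseen _ _ hA) (hseen _ _ hA')
  refine ⟨_, OBlock.epochNo_concat _ _, hact _ (prop_mem_actions.2 ⟨rfl, rfl, A, hA, rfl⟩),
    fun x hx => ?_⟩
  by_cases hxA : x ∈ txsOf A
  · obtain ⟨b, hb, hxb⟩ := mem_txsOf.1 hxA
    exact mem_txsOf.2 ⟨b, List.mem_append_left _ hb, hxb⟩
  · exact mem_txsOf.2 ⟨_, List.mem_append_right _ (List.mem_singleton_self _),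
      mem_fresh.2 ⟨hpool x hx, hxA⟩⟩

/-- A known proposal is accepted by all clients. -/
theorem accepted_of_proposal (hX : X.UnderlaysInEpochs)
    (hTc : ∀ k, P.T k + 2 * Tconf + P.Δ ≤ P.Tc) {i j : Fin 3} (hij : i ≠ j)
    (hi : X.UnderlayLive i Tconf) (hj : X.UnderlayLive j Tconf) {v : ℕ}
    (hq : X.GST ≤ (3 * v + 1) * P.Tc) {B : OBlock Tx}
    (hB : X.KnownBefore Tconf (3 * v + 1) (Carries (leader v) (.prop B v))) {z : X.Client} {t : ℕ}
    (hz : X.online z t) (ht : (3 * v + 2) * P.Tc ≤ t) : B ∈ X.accepted z t := by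
  -- Contracts acknowledge every observed proposal of the leader, so rival proposals from a forked
  -- leader chain do not prevent the certificate `{i, j}` for `B`.
  have hack : ∀ k, X.UnderlayLive k Tconf →
      X.KnownBefore Tconf (3 * v + 2) (Carries k (.ack B v)) := by
    intro k hk
    obtain ⟨r, hseen, -, -, hact⟩ := exists_action hX hk (hTc k) (by omega) hq
    exact hact _ (ack_mem_actions.2 ⟨rfl, hseen _ _ hB⟩)
  have hcom : ∀ k, X.UnderlayLive k Tconf → B ∈ X.commits z t k := by
    intro k hk
    refine mem_commits.2 ⟨t, le_rfl, hz, mem_committed.2 ⟨v, ?_, isCertified_iff.2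
      ⟨{i, j}, (Finset.card_pair hij).ge, fun a ha => ?_⟩⟩⟩
    · exact mem_run_seen.2 (.inl (hB.recorded hk hz
        ((Nat.mul_le_mul_right _ (by omega)).trans ht)))
    · have ha' : X.UnderlayLive a Tconf := by
        rcases Finset.mem_insert.1 ha with rfl | ha
        · exact hi
        · exact Finset.mem_singleton.1 ha ▸ hj
      exact mem_run_seen.2 (.inl ((hack a ha').recorded hk hz ht))
  exact mem_acceptedBlocks.2 ⟨i, j, hij, hcom i hi, hcom j hj⟩

theorem epochNo_le_of_prefix {A C : OBlock Tx} (hne : A ≠ []) (hA : A <+: C)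
    (hC : ∀ b ∈ C, b.epoch ≤ OBlock.epochNo C) : OBlock.epochNo A ≤ OBlock.epochNo C := by
  obtain ⟨A', b, rfl⟩ := (List.eq_nil_or_concat A).resolve_left hne
  rw [List.concat_eq_append] at hA ⊢
  rw [OBlock.epochNo_concat]
  exact hC b (hA.subset (by simp))

/-- A block that all clients accept from time `D` on precedes, with its chain, all finalized blocks
that are dated later than `D`. -/
theorem exists_prefix_finalized (hX : X.UnderlaysInEpochs) {B : OBlock Tx} {z : X.Client} {D : ℕ}
    (hBD : OBlock.epochNo B * (3 * P.Tc) ≤ D)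
    (hB : ∀ t, D ≤ t → X.online z t → B ∈ X.accepted z t) {t : ℕ} (ht : D ≤ t)
    (hz : X.online z t) :
    ∃ F, F <+: X.finalized z t ∧ (∀ A ∈ F, OBlock.epochNo A * (3 * P.Tc) ≤ D) ∧
      ∀ A, A ≠ [] → A <+: B → A ∈ F := by
  set p : OBlock Tx → Prop := fun A => OBlock.epochNo A * (3 * P.Tc) ≤ D with hp
  have hpre : ∀ s, ∀ C ∈ X.accepted z s, p C → ∀ A, A ≠ [] → A <+: C → p A :=
    fun s C hC hpC A hne hA => (Nat.mul_le_mul_right _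
      (epochNo_le_of_prefix hne hA (wellFormed_of_accepted hX hC).2.1)).trans hpC
  -- Either `B` has been appended, after early blocks only, or it is not yet accepted and all
  -- finalized blocks are early.
  have hstep : ∀ F s, (∀ A ∈ F, p A) →
      (∃ F', F' <+: extendBy F (X.accepted z s) ∧ (∀ A ∈ F', p A) ∧
        ∀ A, A ≠ [] → A <+: B → A ∈ F') ∨
      B ∉ X.accepted z s ∧ ∀ A ∈ extendBy F (X.accepted z s), p A := by
    intro F s hF
    by_cases hBs : B ∈ X.accepted z s
    · exact .inl (exists_prefix_extendBy hBs hF fun C hC hle =>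
        hpre s C hC ((Nat.mul_le_mul_right _ hle).trans hBD))
    · refine .inr ⟨hBs, fun A hA => ?_⟩
      rcases mem_extendBy.1 hA with h | ⟨C, hC, hne, hAC⟩
      · exact hF A h
      · refine hpre s C hC ?_ A hne hAC
        obtain ⟨s', hs', hz', k, hk⟩ := exists_committed_of_accepted hC
        -- The client may be offline at `s`, so the argument uses the time `s'` at which it was
        -- online and saw `C` committed.
        have hlt : s' < D := by
          by_contra hge
          exact hBs (accepted_mono hs' (hB s' (by omega) hz'))
        exact (wellFormed_of_committed hX hz' hk).2.2.trans hlt.le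
  have key : ∀ s, (∃ F', F' <+: X.finalized z s ∧ (∀ A ∈ F', p A) ∧
        ∀ A, A ≠ [] → A <+: B → A ∈ F') ∨
      B ∉ X.accepted z s ∧ ∀ A ∈ X.finalized z s, p A := by
    intro s
    induction s with
    | zero => exact hstep [] 0 (by simp)
    | succ s ih =>
      rcases ih with ⟨F', hF', h⟩ | ⟨-, h⟩
      · exact .inl ⟨F', hF'.trans prefix_extendBy, h⟩
      · exact hstep _ _ h
  exact (key t).resolve_right fun h => h.1 (hB t ht hz)

theorem overlayLive (hX : X.UnderlaysInEpochs) (hTc : ∀ k, P.T k + 2 * Tconf + P.Δ ≤ P.Tc)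
    {i j : Fin 3} (hij : i ≠ j) (hi : X.UnderlayLive i Tconf) (hj : X.UnderlayLive j Tconf) :
    X.OverlayLive (11 * P.Tc) := by
  intro x t hx z t' hz ht'
  set D := max X.GST t with hD
  have hTc₀ := P.Tc_pos
  have hTconf : Tconf < P.Tc := by have := hTc 0; have := P.T_pos 0; omega
  -- The constant 11: up to 3 phases until an epoch `u` begins after `D`, up to 3 more until an
  -- epoch `v` followed by a live leader, and 5 from the start of `v` until the proposal of epoch `v
  -- + 1` is accepted.
  obtain ⟨u, hu₀, hu₁, hu₂⟩ :
      ∃ u, 0 < u ∧ D < 3 * (u * P.Tc) ∧ 3 * (u * P.Tc) ≤ D + 3 * P.Tc := by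
    refine ⟨D / (3 * P.Tc) + 1, Nat.succ_pos _, ?_, ?_⟩
    · have := Nat.lt_mul_div_succ D (by omega : 0 < 3 * P.Tc)
      linarith
    · have := Nat.mul_div_le D (3 * P.Tc)
      linarith
  obtain ⟨w, hw₁, hw₂, hw⟩ := leader_consecutive hij (u + 1)
  obtain ⟨v, rfl⟩ : ∃ v, w = v + 1 := ⟨w - 1, by omega⟩
  have hlive : X.UnderlayLive (leader (v + 1)) Tconf := by
    rcases hw with h | h <;> rw [h] <;> assumption
  have hv₁ : u * P.Tc ≤ v * P.Tc := Nat.mul_le_mul_right _ (by omega)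
  have hv₂ : v * P.Tc ≤ u * P.Tc + P.Tc := by
    calc v * P.Tc ≤ (u + 1) * P.Tc := Nat.mul_le_mul_right _ (by omega)
      _ = u * P.Tc + P.Tc := by ring
  have e₁ : (3 * v + 2) * P.Tc = 3 * (v * P.Tc) + 2 * P.Tc := by ring
  have e₂ : 3 * (v + 1) * P.Tc = 3 * (v * P.Tc) + 3 * P.Tc := by ring
  have e₃ : (3 * (v + 1) + 1) * P.Tc = 3 * (v * P.Tc) + 4 * P.Tc := by ring
  have e₄ : (3 * (v + 1) + 2) * P.Tc = 3 * (v * P.Tc) + 5 * P.Tc := by ring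
  have e₅ : (v + 1) * (3 * P.Tc) = 3 * (v * P.Tc) + 3 * P.Tc := by ring
  have hGST : X.GST ≤ D := le_max_left _ _
  obtain ⟨B, hBv, hprop, htx⟩ := exists_proposal hX hTc hij hi hj (v := v) (by omega) (by omega)
    hlive
  have hxB : x ∈ txsOf B := by
    refine htx x (knownBefore_of_input (t := t) (by omega) fun l => ?_)
    exact ⟨_, t, le_max_right _ _, hx l, trivial, rfl⟩
  obtain ⟨F, hF, hdate, hFB⟩ := exists_prefix_finalized hX (B := B) (D := D + 11 * P.Tc)
    (by rw [hBv]; omega)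
    (fun s hs hzs => accepted_of_proposal hX hTc hij hi hj (by omega) hprop hzs (by omega)) ht' hz
  obtain ⟨b, hb, hxb⟩ := mem_txsOf.1 hxB
  obtain ⟨A, C, rfl⟩ := List.append_of_mem hb
  have hA : A ++ [b] ∈ F := hFB _ (by simp) ⟨C, by simp⟩
  -- Only the first occurrence of `x` is kept, possibly in a block `c` other than `b`. As it comes
  -- from `F`, its date is bounded as well.
  obtain ⟨c, hc, hxc⟩ := mem_txsOf.1 (mem_txsOf_sanitize hxb hA)
  refine ⟨c, (sanitize_prefix hF).subset hc, hxc, ?_⟩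
  have hce := List.mem_map_of_mem (f := Block.epoch) hc
  rw [sanitize_map_epoch] at hce
  obtain ⟨A', hA', he⟩ := List.mem_map.1 hce
  rw [← he]
  exact hdate A' hA'

end Execution

theorem mainTheorem5 :
    ∃ c : ℕ, ∀ (Tx : Type) [DecidableEq Tx] (Msg : Fin 3 → Type) (P : Setup Tx Msg),
      -- safety
      (∀ X : Execution P, X.UnderlaysInEpochs → (∀ k, X.UnderlaySafe k) → X.OverlaySafe) ∧
      -- liveness
      (∀ Tconf : ℕ, (∀ k, P.T k + 2 * Tconf + P.Δ ≤ P.Tc) →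
        ∀ X : Execution P, X.UnderlaysInEpochs →
          (∃ i j, i ≠ j ∧ X.UnderlayLive i Tconf ∧ X.UnderlayLive j Tconf) →
          X.OverlayLive (c * P.Tc)) ∧
      -- certificates
      (∀ (Ω : Type) [MeasurableSpace Ω] (μ : MeasureTheory.Measure Ω)
        [MeasureTheory.IsProbabilityMeasure μ] (X : Ω → Execution P)
        (cond : Fin 3 → Ω → Prop) (ε : Fin 3 → ENNReal),
        (∀ ω, (X ω).UnderlaysInEpochs) →
        (∀ k, GeneratesCertificates μ (ε k) (cond k) fun ω => (X ω).UnderlayConflict k) →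
        GeneratesCertificates μ (∑ k, ε k) (fun ω => ∀ k, cond k ω)
          fun ω => (X ω).OverlayConflict) ∧
      -- epochs of fixed duration
      (∀ X : Execution P, X.UnderlaysInEpochs →
        ProceedsInEpochs X.online (3 * P.Tc) (fun z t => {B | B ∈ X.accepted z t}) ∧
        ((∀ k, X.UnderlaySafe k) →
          ProceedsInEpochs X.online (3 * P.Tc) fun z t => {X.overlayLedger z t})) := by
  refine ⟨11, fun Tx _ Msg P => ⟨fun X _ hsafe => X.overlaySafe hsafe, ?_, ?_, fun X hX =>
    ⟨X.accepted_proceedsInEpochs hX, X.overlayLedger_proceedsInEpochs hX⟩⟩⟩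
  · rintro Tconf hTc X hX ⟨i, j, hij, hi, hj⟩
    exact Execution.overlayLive hX hTc hij hi hj
  · intro Ω _ μ _ X cond ε _ h
    exact Execution.overlay_generatesCertificates μ X cond ε h
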